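/- Let $\mathbb K=\mathbb R$ or $\mathbb C$, let $A\in\mathbb K^{m\times m}$, $B\in\mathbb K^{m\times n}$, $Q=Q^*\in\mathbb K^{m\times m}$, $S\in\mathbb K^{n\times m}$, $R=R^*\in\mathbb K^{n\times n}$, and write $M=\begin{bmatrix}Q&S^*\\ S&R\end{bmatrix}$. A trajectory is a pair $(x,u)$ on $[0,\infty)$ with $u\in L^2_{\mathrm{loc}}([0,\infty);\mathbb K^n)$ and $x$ locally absolutely continuous with $\dot x=Ax+Bu$ almost everywhere. Put $$E(x,u,t_0,t_1)=\int_{t_0}^{t_1}\big(\langle Qx,x\rangle+2\operatorname{Re}\langle Sx,u\rangle+\langle Ru,u\rangle\big)\,ds ,$$ $$\Pi(\eta,\zeta)=\begin{bmatrix}(\bar\eta I-A)^{-1}B\\ I\end{bmatrix}^*M\begin{bmatrix}(\zeta I-A)^{-1}B\\ I\end{bmatrix},\qquad \Lambda(P)=\begin{bmatrix}A^*P+(A^*P)^*&PB\\ B^*P&0\end{bmatrix}-M .$$ Suppose that 1. $(A,B)$ is controllable (every state can be steered to every other state in finite time by a trajectory); 2. $(A,B,M)$ is minimally stable: for each $x^0\in\mathbb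 K^m$ there is a trajectory $(x,u)$ with $x(0)=x^0$, $E(x,u,0,t)\le 0$ for all $t\ge 0$, and $x(t)\to 0$ as $t\to\infty$; 3. the rational function $s\mapsto\det\Pi(-s,s)$ is not identically zero; 4. $\Pi(-i\omega,i\omega)\ge 0$ for every $\omega\in\mathbb R$ with $\det(i\omega I-A)\ne 0$. Then the linear matrix inequality $\Lambda(P)\le 0$ admits a positive definite solution $P\in\mathbb K^{m\times m}$, namely the extremal solution $P_+$: there is a Hermitian matrix $P_+\in\mathbb K^{m\times m}$ that represents the required supply, $$\langle P_+x^0,x^0\rangle=\inf\{E(x,u,0,T):\ T\ge 0,\ (x,u)\text{ a trajectory},\ x(0)=0,\ x(T)=x^0\}\quad\text{for all }x^0\in\mathbb K^m,$$ and this $P_+$ satisfies $\Lambda(P_+)\le 0$, is positive definite, and satisfies $P\le P_+$ for every Hermitian solution $P$ of $\Lambda(P)\le 0$. -/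

import Mathlib

open Matrix MeasureTheory Filter Topology
open scoped ComplexOrder

namespace LTI

variable {𝕜 : Type*} [RCLike 𝕜] {m n : ℕ}

/-- `(x, u)` is a trajectory on `[0, ∞)` of the linear system `ẋ = A x + B u`: the input `u` is
locally square integrable on `[0, ∞)`, and `x` is the (Carathéodory) solution of the equation, that
is, `x` is continuous and satisfies the integrated equation. (Equivalently: `x` is locally
absolutely continuous and `ẋ = A x + B u` holds almost everywhere.) Since the state and input spaces
are finite-dimensional, neither local square integrability nor continuity depends on the norms. -/
structure IsTrajectory (A : Matrix (Fin m) (Fin m) 𝕜) (B : Matrix (Fin m) (Fin n) 𝕜)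
    (x : ℝ → Fin m → 𝕜) (u : ℝ → Fin n → 𝕜) : Prop where
  memLp_input : ∀ T : ℝ, MemLp u 2 (volume.restrict (Set.Icc 0 T))
  continuousOn_state : ContinuousOn x (Set.Ici 0)
  state_eq : ∀ t : ℝ, 0 ≤ t → x t = x 0 + ∫ s in (0 : ℝ)..t, (A *ᵥ x s + B *ᵥ u s)

/-- `(A, B)` is controllable: every state can be steered to every other state in finite time. -/
def Controllable (A : Matrix (Fin m) (Fin m) 𝕜) (B : Matrix (Fin m) (Fin n) 𝕜) : Prop :=
  ∀ x₀ x₁ : Fin m → 𝕜, ∃ (x : ℝ → Fin m → 𝕜) (u : ℝ → Fin n → 𝕜) (T : ℝ),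
    0 ≤ T ∧ IsTrajectory A B x u ∧ x 0 = x₀ ∧ x T = x₁

/-- The supply rate `σ(x, u) = ⟨Q x, x⟩ + 2 Re ⟨S x, u⟩ + ⟨R u, u⟩`, where `⟨a, b⟩ = b* a`.
(The first and last terms are real when `Q` and `R` are Hermitian.) -/
noncomputable def supplyRate (Q : Matrix (Fin m) (Fin m) 𝕜) (S : Matrix (Fin n) (Fin m) 𝕜)
    (R : Matrix (Fin n) (Fin n) 𝕜) (x : Fin m → 𝕜) (u : Fin n → 𝕜) : ℝ :=
  RCLike.re (star x ⬝ᵥ Q *ᵥ x) + 2 * RCLike.re (star u ⬝ᵥ S *ᵥ x) + RCLike.re (star u ⬝ᵥ R *ᵥ u)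

/-- The energy `E(x, u, t₀, t₁)` supplied to the system over the time period `[t₀, t₁]`. -/
noncomputable def energy (Q : Matrix (Fin m) (Fin m) 𝕜) (S : Matrix (Fin n) (Fin m) 𝕜)
    (R : Matrix (Fin n) (Fin n) 𝕜) (x : ℝ → Fin m → 𝕜) (u : ℝ → Fin n → 𝕜) (t₀ t₁ : ℝ) : ℝ :=
  ∫ s in t₀..t₁, supplyRate Q S R (x s) (u s)

/-- Minimal stability: from every initial state starts a trajectory which converges to `0` and along
which the energy supplied up to any time is nonpositive. -/
def MinimallyStable (A : Matrix (Fin m) (Fin m) 𝕜) (B : Matrix (Fin m) (Fin n) 𝕜)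
    (Q : Matrix (Fin m) (Fin m) 𝕜) (S : Matrix (Fin n) (Fin m) 𝕜)
    (R : Matrix (Fin n) (Fin n) 𝕜) : Prop :=
  ∀ x₀ : Fin m → 𝕜, ∃ (x : ℝ → Fin m → 𝕜) (u : ℝ → Fin n → 𝕜),
    IsTrajectory A B x u ∧ x 0 = x₀ ∧ (∀ t : ℝ, 0 ≤ t → energy Q S R x u 0 t ≤ 0) ∧
      Tendsto x atTop (𝓝 0)

/-- A matrix over `𝕜` (that is, over `ℝ` or `ℂ`) regarded as a complex matrix. -/
noncomputable def toComplex {k l : Type*} (M : Matrix k l 𝕜) : Matrix k l ℂ :=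
  M.map (RCLike.map 𝕜 ℂ)

/-- The block column with blocks `(s I - A)⁻¹ B` and `I` (meaningful if `det (s I - A) ≠ 0`). -/
noncomputable def resolventColumn (A : Matrix (Fin m) (Fin m) 𝕜) (B : Matrix (Fin m) (Fin n) 𝕜)
    (s : ℂ) : Matrix (Fin m ⊕ Fin n) (Fin n) ℂ :=
  fromRows ((s • (1 : Matrix (Fin m) (Fin m) ℂ) - toComplex A)⁻¹ * toComplex B) 1

/-- The Popov function `Π(η, ζ)`. -/
noncomputable def popov (A : Matrix (Fin m) (Fin m) 𝕜) (B : Matrix (Fin m) (Fin n) 𝕜)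
    (Q : Matrix (Fin m) (Fin m) 𝕜) (S : Matrix (Fin n) (Fin m) 𝕜) (R : Matrix (Fin n) (Fin n) 𝕜)
    (η ζ : ℂ) : Matrix (Fin n) (Fin n) ℂ :=
  (resolventColumn A B (star η))ᴴ * toComplex (fromBlocks Q Sᴴ S R) * resolventColumn A B ζ

/-- The rational function `s ↦ det Π(-s, s)` is not identically zero: it is nonzero at some point
`s` at which both resolvents in `Π(-s, s)` are defined. -/
def PopovDetNotIdenticallyZero (A : Matrix (Fin m) (Fin m) 𝕜) (B : Matrix (Fin m) (Fin n) 𝕜)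
    (Q : Matrix (Fin m) (Fin m) 𝕜) (S : Matrix (Fin n) (Fin m) 𝕜)
    (R : Matrix (Fin n) (Fin n) 𝕜) : Prop :=
  ∃ s : ℂ, (s • (1 : Matrix (Fin m) (Fin m) ℂ) - toComplex A).det ≠ 0 ∧
    (star (-s) • (1 : Matrix (Fin m) (Fin m) ℂ) - toComplex A).det ≠ 0 ∧
    (popov A B Q S R (-s) s).det ≠ 0

/-- The frequency domain inequality: `Π(-iω, iω) ≥ 0` for all real `ω` with
`det (iω I - A) ≠ 0`. -/
def FrequencyInequality (A : Matrix (Fin m) (Fin m) 𝕜) (B : Matrix (Fin m) (Fin n) 𝕜)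
    (Q : Matrix (Fin m) (Fin m) 𝕜) (S : Matrix (Fin n) (Fin m) 𝕜)
    (R : Matrix (Fin n) (Fin n) 𝕜) : Prop :=
  ∀ ω : ℝ, ((Complex.I * ω) • (1 : Matrix (Fin m) (Fin m) ℂ) - toComplex A).det ≠ 0 →
    (popov A B Q S R (-(Complex.I * ω)) (Complex.I * ω)).PosSemidef

/-- The matrix `Λ(P)` of the linear matrix inequality; its upper left block is
`2 Re (A* P) - Q`, where `2 Re N = N + N*`. -/
def lmi (A : Matrix (Fin m) (Fin m) 𝕜) (B : Matrix (Fin m) (Fin n) 𝕜)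
    (Q : Matrix (Fin m) (Fin m) 𝕜) (S : Matrix (Fin n) (Fin m) 𝕜) (R : Matrix (Fin n) (Fin n) 𝕜)
    (P : Matrix (Fin m) (Fin m) 𝕜) : Matrix (Fin m ⊕ Fin n) (Fin m ⊕ Fin n) 𝕜 :=
  fromBlocks (Aᴴ * P + (Aᴴ * P)ᴴ) (P * B) (Bᴴ * P) 0 - fromBlocks Q Sᴴ S R

/-- `P` is a Hermitian solution of the linear matrix inequality `Λ(P) ≤ 0`. -/
def SolvesLMI (A : Matrix (Fin m) (Fin m) 𝕜) (B : Matrix (Fin m) (Fin n) 𝕜)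
    (Q : Matrix (Fin m) (Fin m) 𝕜) (S : Matrix (Fin n) (Fin m) 𝕜) (R : Matrix (Fin n) (Fin n) 𝕜)
    (P : Matrix (Fin m) (Fin m) 𝕜) : Prop :=
  P.IsHermitian ∧ (-lmi A B Q S R P).PosSemidef

/-- The energies of all trajectories which drive the system from the origin to `x₀`. -/
def supplySet (A : Matrix (Fin m) (Fin m) 𝕜) (B : Matrix (Fin m) (Fin n) 𝕜)
    (Q : Matrix (Fin m) (Fin m) 𝕜) (S : Matrix (Fin n) (Fin m) 𝕜) (R : Matrix (Fin n) (Fin n) 𝕜)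
    (x₀ : Fin m → 𝕜) : Set ℝ :=
  {e | ∃ (x : ℝ → Fin m → 𝕜) (u : ℝ → Fin n → 𝕜) (T : ℝ),
    0 ≤ T ∧ IsTrajectory A B x u ∧ x 0 = 0 ∧ x T = x₀ ∧ e = energy Q S R x u 0 T}

/-- `P` is the Hermitian matrix `P₊` of the required supply: `⟨P x₀, x₀⟩` is the infimum (finite and
over a nonempty set) of the energies needed to drive the system from the origin to `x₀`. -/
def IsRequiredSupplyMatrix (A : Matrix (Fin m) (Fin m) 𝕜) (B : Matrix (Fin m) (Fin n) 𝕜)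
    (Q : Matrix (Fin m) (Fin m) 𝕜) (S : Matrix (Fin n) (Fin m) 𝕜) (R : Matrix (Fin n) (Fin n) 𝕜)
    (P : Matrix (Fin m) (Fin m) 𝕜) : Prop :=
  P.IsHermitian ∧ ∀ x₀ : Fin m → 𝕜, IsGLB (supplySet A B Q S R x₀) (RCLike.re (star x₀ ⬝ᵥ P *ᵥ x₀))

end LTI

/-! The matrix sought is that of the required supply $V(x_0)$, the infimum of the energies from $0$
to $x_0$.

$V$ is finite: the Fourier coefficients of a loop at the origin satisfy $i\omega\hat x=A\hat x+B\hat
u$, so by Parseval its energy is a sum of values of the forms $\Pi(-i\omega,i\omega)$ and is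
nonnegative (`integral_quadForm_nonneg_of_loop`); a fixed return to the origin closes any other
trajectory into a loop. Superposition of trajectories gives the parallelogram law, homogeneity and
boundedness on segments, and these make $V$ the quadratic form of a Hermitian $P_+$
(`exists_isHermitian_quadForm_eq`).

Concatenation gives $V(x(t))\le V(x(0))+E(x,u,0,t)$, whose derivative at $t=0$ is $\Lambda(P_+)\le
0$. Conversely, integrating $\Lambda(P)\le 0$ along trajectories from $0$ gives $\langle
Px_0,x_0\rangle\le E$, so $P\le P_+$. Along a minimally stable trajectory $V(x(t))\le V(x_0)$ and
$V(x(t))\to 0$, so $P_+\ge 0$.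

Definiteness follows from extremality. If $V(x_0)=0$ with $x_0\ne 0$, the minimally stable
trajectory dissipates nothing: $K(x,u)=0$ a.e. for $K=-\Lambda(P_+)$. The pencil
$(v,w)\mapsto(sv-Av-Bw,\,K(v,w))$ is injective at some $s_0$ (`eq_zero_of_popov_det_ne_zero`), so
the decaying trajectory produces a zero $l$ with $\operatorname{Re} l<0$ (`exists_stable_zero`) and
a left null vector $(p,q)$ with $p\ne 0$ (`exists_left_null`). For small $\varepsilon>0$, adding
$\varepsilon|p^{T}x|^2$ to $\langle P_+x,x\rangle$ preserves the dissipation inequality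
(`exists_improved_bound`), so $P_+$ would not give the infimum. -/

namespace LTI

/-! ### Quadratic forms of matrices over $\mathbb R$ or $\mathbb C$. -/

section QuadraticForms

variable {𝕜 : Type*} [RCLike 𝕜] {ι : Type*} [Fintype ι]

/-- The real quadratic form `z ↦ Re (z* M z)`. -/
noncomputable def quadForm (M : Matrix ι ι 𝕜) (z : ι → 𝕜) : ℝ :=
  RCLike.re (star z ⬝ᵥ M *ᵥ z)

theorem quadForm_smul_add (M : Matrix ι ι 𝕜) (t : ℝ) (z w : ι → 𝕜) :
    quadForm M (t • z + w) = t ^ 2 * quadForm M z +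
      t * (RCLike.re (star z ⬝ᵥ M *ᵥ w) + RCLike.re (star w ⬝ᵥ M *ᵥ z)) + quadForm M w := by
  simp only [quadForm, star_add, star_smul, mulVec_add, mulVec_smul, add_dotProduct,
    dotProduct_add, smul_dotProduct, dotProduct_smul, map_add, RCLike.smul_re, star_trivial]
  ring

theorem quadForm_smul (M : Matrix ι ι 𝕜) (c : 𝕜) (z : ι → 𝕜) :
    quadForm M (c • z) = ‖c‖ ^ 2 * quadForm M z := by
  simp only [quadForm, star_smul, mulVec_smul, smul_dotProduct, dotProduct_smul, smul_eq_mul]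
  rw [← mul_assoc, RCLike.star_def, RCLike.mul_conj, ← RCLike.ofReal_pow, RCLike.re_ofReal_mul]

theorem quadForm_zero (M : Matrix ι ι 𝕜) : quadForm M 0 = 0 := by
  simp [quadForm]

theorem quadForm_sub (M N : Matrix ι ι 𝕜) (z : ι → 𝕜) :
    quadForm (M - N) z = quadForm M z - quadForm N z := by
  simp [quadForm, sub_mulVec, dotProduct_sub]

theorem continuous_quadForm (M : Matrix ι ι 𝕜) : Continuous (quadForm M) := by
  unfold quadForm
  fun_prop

theorem posSemidef_iff_quadForm {M : Matrix ι ι 𝕜} (hM : M.IsHermitian) :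
    M.PosSemidef ↔ ∀ z, 0 ≤ quadForm M z := by
  rw [posSemidef_iff_dotProduct_mulVec]
  refine ⟨fun h z => (RCLike.nonneg_iff.1 (h.2 z)).1, fun h => ⟨hM, fun z => ?_⟩⟩
  exact RCLike.nonneg_iff.2 ⟨h z, hM.im_star_dotProduct_mulVec_self z⟩

theorem posDef_iff_quadForm {M : Matrix ι ι 𝕜} (hM : M.IsHermitian) :
    M.PosDef ↔ ∀ z, z ≠ 0 → 0 < quadForm M z := by
  rw [posDef_iff_dotProduct_mulVec]
  refine ⟨fun h z hz => (RCLike.pos_iff.1 (h.2 hz)).1, fun h => ⟨hM, fun z hz => ?_⟩⟩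
  exact RCLike.pos_iff.2 ⟨h z hz, hM.im_star_dotProduct_mulVec_self z⟩

theorem mulVec_eq_zero_of_quadForm_eq_zero {M : Matrix ι ι 𝕜} (hM : M.PosSemidef) {z : ι → 𝕜}
    (hz : quadForm M z = 0) : M *ᵥ z = 0 := by
  refine (hM.dotProduct_mulVec_zero_iff z).1 (RCLike.ext ?_ ?_)
  · simpa [quadForm] using hz
  · simpa using hM.1.im_star_dotProduct_mulVec_self z

theorem star_dotProduct_mulVec_of_isHermitian {M : Matrix ι ι 𝕜} (hM : M.IsHermitian)
    (z w : ι → 𝕜) : star (star z ⬝ᵥ M *ᵥ w) = star w ⬝ᵥ M *ᵥ z := by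
  rw [star_dotProduct, star_star, star_mulVec, hM.eq, dotProduct_mulVec]

theorem re_dotProduct_mulVec_comm {M : Matrix ι ι 𝕜} (hM : M.IsHermitian) (z w : ι → 𝕜) :
    RCLike.re (star z ⬝ᵥ M *ᵥ w) = RCLike.re (star w ⬝ᵥ M *ᵥ z) := by
  rw [← star_dotProduct_mulVec_of_isHermitian hM z w, RCLike.star_def, RCLike.conj_re]

end QuadraticForms

/-! ### The parallelogram law and real bilinearity of the polar form. -/

section Parallelogram

/-- An additive function on `ℝ` which is bounded on `[0, 1]` and vanishes at `1` is zero. -/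
theorem eq_zero_of_additive_of_bounded {g : ℝ → ℝ} (hadd : ∀ s t, g (s + t) = g s + g t)
    (h1 : g 1 = 0) {C : ℝ} (hC : ∀ t ∈ Set.Icc (0 : ℝ) 1, |g t| ≤ C) (t : ℝ) : g t = 0 := by
  let G : ℝ →+ ℝ := AddMonoidHom.mk' g hadd
  have hint : ∀ k : ℤ, g k = 0 := fun k => by
    have : G ((k : ℤ) • (1 : ℝ)) = k • G 1 := map_zsmul G k 1
    simpa [G, h1] using this
  -- Since `g` vanishes on the integers, its values are those at fractional parts: the bound becomes
  -- global, and additivity improves it to $C/n$ for every $n$.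
  have hall : ∀ s, |g s| ≤ C := fun s => by
    have h := hadd (⌊s⌋ : ℝ) (Int.fract s)
    rw [Int.floor_add_fract, hint, zero_add] at h
    rw [h]
    exact hC _ ⟨Int.fract_nonneg s, (Int.fract_lt_one s).le⟩
  have hn : ∀ n : ℕ, n * |g t| ≤ C := fun n => by
    have : G (n • t) = n • G t := map_nsmul G n t
    have h2 : g (n * t) = n * g t := by simpa [G] using this
    have h3 := hall (n * t)
    rwa [h2, abs_mul, Nat.abs_cast] at h3
  by_contra hne
  have hpos : 0 < |g t| := abs_pos.2 hne
  obtain ⟨n, hn'⟩ := exists_nat_gt (C / |g t|)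
  rw [div_lt_iff₀ hpos] at hn'
  exact absurd (hn n) (not_le.2 hn')

variable {E : Type*} [AddCommGroup E]

/-- The polar form of a function. -/
def polarForm (V : E → ℝ) (x y : E) : ℝ := V (x + y) - V x - V y

theorem polarForm_comm (V : E → ℝ) (x y : E) : polarForm V x y = polarForm V y x := by
  unfold polarForm
  rw [add_comm x y]
  ring

/-- Jordan–von Neumann: `h1 - h2 + h3` eliminates $V(x-x'+y)$ and $V(x+x'-y)$, and `h4` the
remaining $V(x'-y)$. -/
theorem polarForm_add_left {V : E → ℝ}
    (hpar : ∀ x y, V (x + y) + V (x - y) = 2 * V x + 2 * V y) (x x' y : E) :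
    polarForm V (x + x') y = polarForm V x y + polarForm V x' y := by
  have h1 := hpar (x + y) x'
  have h2 := hpar x (x' - y)
  have h3 := hpar (x + x') y
  have h4 := hpar x' y
  rw [show x + y + x' = x + x' + y by abel, show x + y - x' = x - (x' - y) by abel] at h1
  rw [show x + (x' - y) = x + x' - y by abel] at h2
  unfold polarForm
  linarith

/-- Additivity in `t` and boundedness on $[0,1]$ force linearity. Upper bounds suffice, because
$V(tx+y)=2t^2V(x)+2V(y)-V(tx-y)$ turns one at $-y$ into a lower bound at $y$. -/
theorem polarForm_smul_left [Module ℝ E] {V : E → ℝ}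
    (hpar : ∀ x y, V (x + y) + V (x - y) = 2 * V x + 2 * V y)
    (hhom : ∀ (t : ℝ) x, V (t • x) = t ^ 2 * V x)
    (hbdd : ∀ x y, ∃ C, ∀ t ∈ Set.Icc (0 : ℝ) 1, V (t • x + y) ≤ C) (t : ℝ) (x y : E) :
    polarForm V (t • x) y = t * polarForm V x y := by
  have hadd : ∀ s t : ℝ, polarForm V ((s + t) • x) y =
      polarForm V (s • x) y + polarForm V (t • x) y := fun s t => by
    rw [add_smul, polarForm_add_left hpar]
  obtain ⟨C₁, hC₁⟩ := hbdd x y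
  obtain ⟨C₂, hC₂⟩ := hbdd x (-y)
  have key := eq_zero_of_additive_of_bounded
    (g := fun t => polarForm V (t • x) y - t * polarForm V x y)
    (fun s t => by simp only [hadd]; ring) (by simp)
    (C := |C₁| + |C₂| + 3 * |V x| + 3 * |V y| + |polarForm V x y|) (fun t ht => by
      have ht2 : 0 ≤ t ^ 2 := by positivity
      have ht3 : t ^ 2 ≤ 1 := pow_le_one₀ ht.1 ht.2
      have h1 := hC₁ t ht
      have h2 := hC₂ t ht
      have h3 := hpar (t • x) y
      rw [hhom] at h3
      rw [← sub_eq_add_neg] at h2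
      have h4 : |t ^ 2 * V x| ≤ |V x| := by
        rw [abs_mul, abs_of_nonneg ht2]
        exact mul_le_of_le_one_left (abs_nonneg _) ht3
      have h5 : |t * polarForm V x y| ≤ |polarForm V x y| := by
        rw [abs_mul, abs_of_nonneg ht.1]
        exact mul_le_of_le_one_left (abs_nonneg _) ht.2
      have h6 := abs_le.1 h4
      have h7 := abs_le.1 h5
      have h8 := le_abs_self C₁
      have h9 := le_abs_self C₂
      have h10 := neg_abs_le (V y)
      have h11 := le_abs_self (V y)
      have h12 := abs_nonneg C₁
      have h13 := abs_nonneg C₂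
      have h14 := abs_nonneg (V x)
      have h15 := abs_nonneg (V y)
      have h16 : polarForm V (t • x) y = V (t • x + y) - t ^ 2 * V x - V y := by
        rw [polarForm, hhom]
      rw [h16, abs_le]
      constructor <;> linarith [h6.1, h6.2, h7.1, h7.2]) t
  linarith [key]

end Parallelogram

/-! ### From the parallelogram law to a Hermitian matrix. -/

section Representation

variable {𝕜 : Type*} [RCLike 𝕜] {ι : Type*} [Fintype ι] [DecidableEq ι]

/-- A function satisfying the parallelogram law, homogeneous of degree two, and bounded above on
segments is the quadratic form of a Hermitian matrix. -/
theorem exists_isHermitian_quadForm_eq {V : (ι → 𝕜) → ℝ}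
    (hpar : ∀ x y, V (x + y) + V (x - y) = 2 * V x + 2 * V y)
    (hhom : ∀ (c : 𝕜) x, V (c • x) = ‖c‖ ^ 2 * V x)
    (hbdd : ∀ x y, ∃ C, ∀ t ∈ Set.Icc (0 : ℝ) 1, V (t • x + y) ≤ C) :
    ∃ P : Matrix ι ι 𝕜, P.IsHermitian ∧ ∀ x, quadForm P x = V x := by
  have hhomR : ∀ (t : ℝ) x, V (t • x) = t ^ 2 * V x := fun t x => by
    have := hhom (t : 𝕜) x
    rwa [RCLike.norm_ofReal, sq_abs, ← RCLike.real_smul_eq_coe_smul] at this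
  set p := polarForm V with hp
  have p_comm : ∀ x y, p x y = p y x := polarForm_comm V
  have p_add : ∀ x x' y, p (x + x') y = p x y + p x' y := polarForm_add_left hpar
  have p_smul : ∀ (t : ℝ) x y, p (t • x) y = t * p x y := polarForm_smul_left hpar hhomR hbdd
  have p_add' : ∀ x y y', p x (y + y') = p x y + p x y' := fun x y y' => by
    rw [p_comm, p_add, p_comm y, p_comm y']
  have p_smul' : ∀ (t : ℝ) x y, p x (t • y) = t * p x y := fun t x y => by
    rw [p_comm, p_smul, p_comm y]
  have p_cc : ∀ (c : 𝕜) x y, p (c • x) (c • y) = ‖c‖ ^ 2 * p x y := fun c x y => by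
    simp only [hp, polarForm, ← smul_add, hhom]
    ring
  have p_zero : ∀ y, p 0 y = 0 := fun y => by
    have := p_smul 0 0 y
    simpa using this
  -- Write $y=c(c^{-1}y)$, pull out $|c|^2$, and use $|c|^2c^{-1}=\bar c$.
  have p_adj : ∀ (c : 𝕜) x y, p (c • x) y = p x (star c • y) := fun c x y => by
    by_cases hc : c = 0
    · simp [hc, p_zero, p_comm x]
    · have h1 : y = c • (c⁻¹ • y) := by rw [smul_smul, mul_inv_cancel₀ hc, one_smul]
      rw [h1, p_cc, ← p_smul', ← h1, RCLike.real_smul_eq_coe_smul (K := 𝕜), smul_smul]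
      congr 2
      rw [RCLike.star_def, RCLike.ofReal_pow, ← RCLike.conj_mul, mul_assoc, mul_inv_cancel₀ hc,
        mul_one]
  -- The sesquilinear form with $p=2\operatorname{Re}h$; over $\mathbb R$, where `RCLike.I` is $0$,
  -- it is $p/2$.
  let h : (ι → 𝕜) → (ι → 𝕜) → 𝕜 := fun x y =>
    (1 / 2 : ℝ) • ((p x y : 𝕜) - RCLike.I * (p x ((RCLike.I : 𝕜) • y) : 𝕜))
  have h_smul : ∀ (c : 𝕜) x y, p x (c • y) = 2 * RCLike.re (c * h x y) := fun c x y => by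
    have h1 : c • y = RCLike.re c • y + RCLike.im c • ((RCLike.I : 𝕜) • y) := by
      conv_lhs => rw [← RCLike.re_add_im c]
      rw [add_smul, mul_smul, ← RCLike.real_smul_eq_coe_smul, ← RCLike.real_smul_eq_coe_smul]
    rw [h1, p_add', p_smul', p_smul']
    have h2 : RCLike.im (h x y) * RCLike.im c = -(1 / 2) * p x ((RCLike.I : 𝕜) • y) * RCLike.im c := by
      have h3 := RCLike.I_im c
      simp only [h, RCLike.smul_im, map_sub, RCLike.ofReal_im, RCLike.mul_im, RCLike.ofReal_re,
        mul_zero, zero_sub, zero_add]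
      linear_combination (-(1 / 2) * p x ((RCLike.I : 𝕜) • y)) * h3
    have h4 : RCLike.re (h x y) = 1 / 2 * p x y := by
      simp [h, RCLike.smul_re, RCLike.mul_re]
    rw [RCLike.mul_re, h4]
    linear_combination 2 * h2
  have h_herm : ∀ x y, star (h y x) = h x y := fun x y => by
    have h1 : p y ((RCLike.I : 𝕜) • x) = -p x ((RCLike.I : 𝕜) • y) := by
      rw [p_comm, p_adj, RCLike.star_def, RCLike.conj_I, neg_smul,
        show -((RCLike.I : 𝕜) • y) = (-1 : ℝ) • ((RCLike.I : 𝕜) • y) by simp, p_smul']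
      ring
    simp only [h, h1, star_smul, star_trivial, star_sub, star_mul', RCLike.star_def,
      RCLike.conj_ofReal, RCLike.conj_I, p_comm y x]
    congr 1
    push_cast
    ring
  let e : ι → ι → 𝕜 := fun i => Pi.single i 1
  refine ⟨Matrix.of fun i j => h (e i) (e j), ?_, fun x => ?_⟩
  · ext i j
    simp only [conjTranspose_apply, of_apply]
    exact h_herm _ _
  · have hx : x = ∑ i, x i • e i := by
      ext k
      simp [e, Finset.sum_apply, Pi.single_apply]
    have sum_left : ∀ (s : Finset ι) (f : ι → ι → 𝕜) y,
        p (∑ i ∈ s, f i) y = ∑ i ∈ s, p (f i) y := fun s f y => by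
      classical
      induction s using Finset.induction_on with
      | empty => simp [p_zero]
      | insert a s ha ih => rw [Finset.sum_insert ha, Finset.sum_insert ha, p_add, ih]
    have sum_right : ∀ (s : Finset ι) (f : ι → ι → 𝕜) y,
        p y (∑ i ∈ s, f i) = ∑ i ∈ s, p y (f i) := fun s f y => by
      rw [p_comm, sum_left]
      exact Finset.sum_congr rfl fun i _ => p_comm _ _
    have hVx : p x x = 2 * V x := by
      have := hhomR 2 x
      rw [hp, polarForm, ← two_smul ℝ x, this]
      ring
    have hexp : p x x = 2 * quadForm (Matrix.of fun i j => h (e i) (e j)) x := by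
      conv_lhs => rw [hx]
      simp only [quadForm, dotProduct, mulVec, sum_left, sum_right, of_apply, map_sum,
        Finset.mul_sum, Pi.star_apply]
      refine Finset.sum_congr rfl fun i _ => Finset.sum_congr rfl fun j _ => ?_
      rw [p_adj, smul_smul, h_smul]
      congr 2
      ring
    linarith

end Representation

end LTI

namespace LTI

/-! ### Integration by parts for primitives of integrable functions. -/

section ProductRule

variable {𝕜 : Type*} [RCLike 𝕜]

theorem absolutelyContinuousOnInterval_const {F : Type*} [SeminormedAddCommGroup F] (c : F)
    (a b : ℝ) : AbsolutelyContinuousOnInterval (fun _ => c) a b :=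
  ((LipschitzWith.const c).lipschitzOnWith).absolutelyContinuousOnInterval

theorem absolutelyContinuousOnInterval_congr {X : Type*} [PseudoMetricSpace X] {f g : ℝ → X}
    {a b : ℝ} (hf : AbsolutelyContinuousOnInterval f a b) (h : Set.EqOn f g (Set.uIcc a b)) :
    AbsolutelyContinuousOnInterval g a b := by
  rw [absolutelyContinuousOnInterval_iff] at hf ⊢
  intro ε hε
  obtain ⟨δ, hδ, H⟩ := hf ε hε
  refine ⟨δ, hδ, fun E hE hlt => ?_⟩
  have := H E hE hlt
  rwa [Finset.sum_congr rfl fun i hi => by rw [h (hE.1 i hi).1, h (hE.1 i hi).2]] at this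

/-- The primitive of an integrable function with values in `ℝ` or `ℂ` is absolutely continuous. -/
theorem absolutelyContinuousOnInterval_integral {f : ℝ → 𝕜} {a b : ℝ}
    (hf : IntervalIntegrable f volume a b) :
    AbsolutelyContinuousOnInterval (fun t => ∫ s in a..t, f s) a b := by
  have hre : IntervalIntegrable (fun s => RCLike.re (f s)) volume a b :=
    ⟨hf.1.re, hf.2.re⟩
  have him : IntervalIntegrable (fun s => RCLike.im (f s)) volume a b :=
    ⟨hf.1.im, hf.2.im⟩
  have h1 := (hre.absolutelyContinuousOnInterval_intervalIntegral Set.left_mem_uIcc).smul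
    (absolutelyContinuousOnInterval_const (1 : 𝕜) a b)
  have h2 := (him.absolutelyContinuousOnInterval_intervalIntegral Set.left_mem_uIcc).smul
    (absolutelyContinuousOnInterval_const (RCLike.I : 𝕜) a b)
  refine absolutelyContinuousOnInterval_congr (h1.add h2) fun t ht => ?_
  have hft : IntervalIntegrable f volume a t := hf.mono_set (Set.uIcc_subset_uIcc_left ht)
  have e1 := RCLike.reCLM.intervalIntegral_comp_comm hft
  have e2 := RCLike.imCLM.intervalIntegral_comp_comm hft
  simp only [RCLike.reCLM_apply, RCLike.imCLM_apply] at e1 e2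
  simp only [Pi.add_apply, Pi.smul_apply', e1, e2]
  conv_rhs => rw [← RCLike.re_add_im (∫ s in a..t, f s)]
  simp only [RCLike.real_smul_eq_coe_mul, mul_one]

/-- The product rule for absolutely continuous functions, in integrated form. -/
theorem integral_mul_add_mul_eq_sub {f g F G : ℝ → 𝕜} {T : ℝ} (hT : 0 ≤ T)
    (hf : IntervalIntegrable f volume 0 T) (hg : IntervalIntegrable g volume 0 T)
    (hF : ∀ t ∈ Set.Icc 0 T, F t = F 0 + ∫ s in (0 : ℝ)..t, f s)
    (hG : ∀ t ∈ Set.Icc 0 T, G t = G 0 + ∫ s in (0 : ℝ)..t, g s) :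
    ∫ s in (0 : ℝ)..T, (f s * G s + F s * g s) = F T * G T - F 0 * G 0 := by
  -- `F` and `G` are controlled on $[0,T]$ only; the globally defined primitives have two-sided
  -- derivatives a.e. there. Their product minus the primitive of its derivative is absolutely
  -- continuous with zero derivative, hence constant.
  set F' : ℝ → 𝕜 := (fun _ => F 0) + fun t => ∫ s in (0 : ℝ)..t, f s with hF'
  set G' : ℝ → 𝕜 := (fun _ => G 0) + fun t => ∫ s in (0 : ℝ)..t, g s with hG'
  have hFac : AbsolutelyContinuousOnInterval F' 0 T :=
    (absolutelyContinuousOnInterval_const _ _ _).add (absolutelyContinuousOnInterval_integral hf)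
  have hGac : AbsolutelyContinuousOnInterval G' 0 T :=
    (absolutelyContinuousOnInterval_const _ _ _).add (absolutelyContinuousOnInterval_integral hg)
  have hint : IntervalIntegrable (fun s => f s * G' s + F' s * g s) volume 0 T :=
    (hf.mul_continuousOn hGac.continuousOn).add (hg.continuousOn_mul hFac.continuousOn)
  have hH := (hFac.smul hGac).sub (absolutelyContinuousOnInterval_integral hint)
  obtain ⟨C, hC⟩ := hH.const_of_ae_hasDerivAt_zero (by
    filter_upwards [hf.ae_hasDerivAt_integral, hg.ae_hasDerivAt_integral,
      hint.ae_hasDerivAt_integral] with t h1 h2 h3 ht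
    have d1 : HasDerivAt F' (f t) t := by
      simpa using (hasDerivAt_const t (F 0)).add (h1 ht 0 Set.left_mem_uIcc)
    have d2 : HasDerivAt G' (g t) t := by
      simpa using (hasDerivAt_const t (G 0)).add (h2 ht 0 Set.left_mem_uIcc)
    have d3 := (d1.mul d2).sub (h3 ht 0 Set.left_mem_uIcc)
    rwa [sub_self] at d3)
  have e0 := hC 0 Set.left_mem_uIcc
  have e1 := hC T Set.right_mem_uIcc
  have hFT : ∀ t ∈ Set.Icc 0 T, F' t = F t := fun t ht => (hF t ht).symm
  have hGT : ∀ t ∈ Set.Icc 0 T, G' t = G t := fun t ht => (hG t ht).symm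
  have hcongr : ∫ s in (0 : ℝ)..T, (f s * G s + F s * g s) =
      ∫ s in (0 : ℝ)..T, (f s * G' s + F' s * g s) := by
    refine intervalIntegral.integral_congr fun s hs => ?_
    rw [Set.uIcc_of_le hT] at hs
    simp only [hFT s hs, hGT s hs]
  simp only [Pi.sub_apply, smul_eq_mul, Pi.mul_apply, intervalIntegral.integral_same, sub_zero,
    hFT 0 ⟨le_rfl, hT⟩, hGT 0 ⟨le_rfl, hT⟩, hFT T ⟨hT, le_rfl⟩, hGT T ⟨hT, le_rfl⟩] at e0 e1
  rw [hcongr, e0, ← e1]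
  ring

end ProductRule
end LTI

namespace LTI

/-! ### Trajectories: integrability, linearity, concatenation, derivative of a quadratic form. -/

section Trajectories

variable {𝕜 : Type*} [RCLike 𝕜] {m n : ℕ}

theorem supplyRate_eq_quadForm (Q : Matrix (Fin m) (Fin m) 𝕜) (S : Matrix (Fin n) (Fin m) 𝕜)
    (R : Matrix (Fin n) (Fin n) 𝕜) (x : Fin m → 𝕜) (u : Fin n → 𝕜) :
    supplyRate Q S R x u = quadForm (fromBlocks Q Sᴴ S R) (Sum.elim x u) := by
  have h : star (star x ⬝ᵥ Sᴴ *ᵥ u) = star u ⬝ᵥ S *ᵥ x := by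
    rw [star_dotProduct, star_star, star_mulVec, conjTranspose_conjTranspose, dotProduct_mulVec]
  have h' : RCLike.re (star x ⬝ᵥ Sᴴ *ᵥ u) = RCLike.re (star u ⬝ᵥ S *ᵥ x) := by
    rw [← h, RCLike.star_def, RCLike.conj_re]
  have e : star (Sum.elim x u) = Sum.elim (star x) (star u) := by
    ext i
    cases i <;> rfl
  rw [quadForm, fromBlocks_mulVec, e, sumElim_dotProduct_sumElim]
  simp only [Sum.elim_comp_inl, Sum.elim_comp_inr, dotProduct_add, map_add, h', supplyRate]
  ring

theorem quadForm_eq_sum {ι : Type*} [Fintype ι] (M : Matrix ι ι 𝕜) (z : ι → 𝕜) :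
    quadForm M z = ∑ i, ∑ j, RCLike.re (star (z i) * (M i j * z j)) := by
  simp only [quadForm, dotProduct, mulVec, Finset.mul_sum, Pi.star_apply, map_sum]

theorem integrable_star_mul_mul {ι : Type*} [Fintype ι] {z : ℝ → ι → 𝕜} {μ : Measure ℝ}
    (hz : MemLp z 2 μ) (c : 𝕜) (i j : ι) :
    Integrable (fun s => star (z s i) * (c * z s j)) μ := by
  have h1 : MemLp (fun s => star (z s i)) 2 μ := (memLp_pi_iff.1 hz i).star
  have h2 : MemLp (fun s => c * z s j) 2 μ := (memLp_pi_iff.1 hz j).const_mul _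
  exact h1.integrable_mul h2

theorem integrable_quadForm {ι : Type*} [Fintype ι] (M : Matrix ι ι 𝕜) {z : ℝ → ι → 𝕜}
    {μ : Measure ℝ} (hz : MemLp z 2 μ) : Integrable (fun s => quadForm M (z s)) μ := by
  simp only [quadForm_eq_sum]
  exact integrable_finsetSum _ fun i _ => integrable_finsetSum _ fun j _ =>
    (integrable_star_mul_mul hz (M i j) i j).re

theorem integral_quadForm {ι : Type*} [Fintype ι] (M : Matrix ι ι 𝕜) {z : ℝ → ι → 𝕜}
    {μ : Measure ℝ} (hz : MemLp z 2 μ) :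
    ∫ s, quadForm M (z s) ∂μ = ∑ i, ∑ j, RCLike.re (∫ s, star (z s i) * (M i j * z s j) ∂μ) := by
  have h : ∀ i j, Integrable (fun s => RCLike.re (star (z s i) * (M i j * z s j))) μ :=
    fun i j => (integrable_star_mul_mul hz (M i j) i j).re
  simp only [quadForm_eq_sum]
  rw [integral_finsetSum _ fun i _ => integrable_finsetSum _ fun j _ => h i j]
  refine Finset.sum_congr rfl fun i _ => ?_
  rw [integral_finsetSum _ fun j _ => h i j]
  exact Finset.sum_congr rfl fun j _ => integral_re (integrable_star_mul_mul hz (M i j) i j)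

/-- Serves `exists_concat` twice, for the state equation and for the energy. -/
theorem integral_eq_add_of_eq_shift {F : Type*} [NormedAddCommGroup F] [NormedSpace ℝ F]
    {f f₁ f₂ : ℝ → F} {T t : ℝ} (hT : 0 ≤ T) (ht : 0 ≤ t) (h₁ : ∀ s ≤ T, f s = f₁ s)
    (h₂ : ∀ s, T < s → f s = f₂ (s - T)) (i₁ : IntervalIntegrable f₁ volume 0 T)
    (i₂ : IntervalIntegrable f₂ volume 0 t) :
    ∫ s in (0 : ℝ)..(T + t), f s = (∫ s in (0 : ℝ)..T, f₁ s) + ∫ s in (0 : ℝ)..t, f₂ s := by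
  have c₁ : ∀ s ∈ Set.uIoc 0 T, f₁ s = f s := fun s hs => by
    rw [Set.uIoc_of_le hT] at hs
    exact (h₁ s hs.2).symm
  have c₂ : ∀ s ∈ Set.uIoc T (T + t), f₂ (s - T) = f s := fun s hs => by
    rw [Set.uIoc_of_le (by linarith)] at hs
    exact (h₂ s hs.1).symm
  have j₂ : IntervalIntegrable (fun s => f₂ (s - T)) volume T (T + t) := by
    have := i₂.comp_sub_right T
    rwa [zero_add, add_comm t T] at this
  rw [← intervalIntegral.integral_add_adjacent_intervals (i₁.congr c₁) (j₂.congr c₂),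
    ← intervalIntegral.integral_congr_ae (ae_of_all _ c₁),
    ← intervalIntegral.integral_congr_ae (ae_of_all _ c₂)]
  congr 1
  rw [intervalIntegral.integral_comp_sub_right f₂ T, sub_self, add_sub_cancel_left]

variable {A : Matrix (Fin m) (Fin m) 𝕜} {B : Matrix (Fin m) (Fin n) 𝕜}

namespace IsTrajectory

theorem memLp_state {x : ℝ → Fin m → 𝕜} {u : ℝ → Fin n → 𝕜} (h : IsTrajectory A B x u) (T : ℝ) :
    MemLp x 2 (volume.restrict (Set.Icc 0 T)) := by
  have hc : ContinuousOn x (Set.Icc 0 T) := h.continuousOn_state.mono Set.Icc_subset_Ici_self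
  obtain ⟨C, hC⟩ := isCompact_Icc.exists_bound_of_continuousOn hc
  exact MemLp.of_bound (hc.aestronglyMeasurable measurableSet_Icc) C
    ((ae_restrict_iff' measurableSet_Icc).2 (ae_of_all _ hC))

theorem memLp_pair {x : ℝ → Fin m → 𝕜} {u : ℝ → Fin n → 𝕜} (h : IsTrajectory A B x u) (T : ℝ) :
    MemLp (fun s => Sum.elim (x s) (u s)) 2 (volume.restrict (Set.Icc 0 T)) := by
  rw [memLp_pi_iff]
  rintro (i | i)
  · exact memLp_pi_iff.1 (h.memLp_state T) i
  · exact memLp_pi_iff.1 (h.memLp_input T) i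

theorem intervalIntegrable_quadForm {x : ℝ → Fin m → 𝕜} {u : ℝ → Fin n → 𝕜}
    (h : IsTrajectory A B x u) (M : Matrix (Fin m ⊕ Fin n) (Fin m ⊕ Fin n) 𝕜) {T : ℝ}
    (hT : 0 ≤ T) :
    IntervalIntegrable (fun s => quadForm M (Sum.elim (x s) (u s))) volume 0 T := by
  rw [intervalIntegrable_iff_integrableOn_Icc_of_le hT]
  exact integrable_quadForm M (h.memLp_pair T)

theorem intervalIntegrable_supplyRate {x : ℝ → Fin m → 𝕜} {u : ℝ → Fin n → 𝕜}
    (h : IsTrajectory A B x u) (Q : Matrix (Fin m) (Fin m) 𝕜) (S : Matrix (Fin n) (Fin m) 𝕜)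
    (R : Matrix (Fin n) (Fin n) 𝕜) {T : ℝ} (hT : 0 ≤ T) :
    IntervalIntegrable (fun s => supplyRate Q S R (x s) (u s)) volume 0 T := by
  simp only [supplyRate_eq_quadForm]
  exact h.intervalIntegrable_quadForm _ hT

theorem intervalIntegrable_velocity {x : ℝ → Fin m → 𝕜} {u : ℝ → Fin n → 𝕜}
    (h : IsTrajectory A B x u) {T : ℝ} (hT : 0 ≤ T) :
    IntervalIntegrable (fun s => A *ᵥ x s + B *ᵥ u s) volume 0 T := by
  rw [intervalIntegrable_iff_integrableOn_Icc_of_le hT]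
  have hx : Integrable x (volume.restrict (Set.Icc 0 T)) := (h.memLp_state T).integrable (by norm_num)
  have hu : Integrable u (volume.restrict (Set.Icc 0 T)) := (h.memLp_input T).integrable (by norm_num)
  exact (((mulVecLin A).restrictScalars ℝ).toContinuousLinearMap.integrable_comp hx).add
    (((mulVecLin B).restrictScalars ℝ).toContinuousLinearMap.integrable_comp hu)

theorem state_apply_eq {x : ℝ → Fin m → 𝕜} {u : ℝ → Fin n → 𝕜} (h : IsTrajectory A B x u) {t : ℝ}
    (ht : 0 ≤ t) (i : Fin m) :
    x t i = x 0 i + ∫ s in (0 : ℝ)..t, (A *ᵥ x s + B *ᵥ u s) i := by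
  conv_lhs => rw [h.state_eq t ht]
  rw [Pi.add_apply]
  congr 1
  exact ((ContinuousLinearMap.proj (R := ℝ) (φ := fun _ : Fin m => 𝕜) i).intervalIntegral_comp_comm
    (h.intervalIntegrable_velocity ht)).symm

theorem zero : IsTrajectory A B 0 0 where
  memLp_input _ := MemLp.zero
  continuousOn_state := continuousOn_const
  state_eq t _ := by simp

theorem add {x y : ℝ → Fin m → 𝕜} {u v : ℝ → Fin n → 𝕜} (h : IsTrajectory A B x u)
    (k : IsTrajectory A B y v) : IsTrajectory A B (x + y) (u + v) where
  memLp_input T := (h.memLp_input T).add (k.memLp_input T)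
  continuousOn_state := h.continuousOn_state.add k.continuousOn_state
  state_eq t ht := by
    have e : ∀ s, A *ᵥ (x + y) s + B *ᵥ (u + v) s =
        (A *ᵥ x s + B *ᵥ u s) + (A *ᵥ y s + B *ᵥ v s) := fun s => by
      simp only [Pi.add_apply, mulVec_add]
      abel
    simp only [e]
    rw [intervalIntegral.integral_add (h.intervalIntegrable_velocity ht)
      (k.intervalIntegrable_velocity ht), Pi.add_apply, Pi.add_apply, h.state_eq t ht,
      k.state_eq t ht]
    abel

theorem smul {x : ℝ → Fin m → 𝕜} {u : ℝ → Fin n → 𝕜} (h : IsTrajectory A B x u) (c : 𝕜) :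
    IsTrajectory A B (c • x) (c • u) where
  memLp_input T := (h.memLp_input T).const_smul c
  continuousOn_state := h.continuousOn_state.const_smul c
  state_eq t ht := by
    have e : ∀ s, A *ᵥ (c • x) s + B *ᵥ (c • u) s = c • (A *ᵥ x s + B *ᵥ u s) := fun s => by
      simp only [Pi.smul_apply, mulVec_smul, smul_add]
    simp only [e]
    rw [intervalIntegral.integral_smul, Pi.smul_apply, Pi.smul_apply, h.state_eq t ht, smul_add]

/-- Concatenation of two trajectories. -/
theorem exists_concat {x₁ x₂ : ℝ → Fin m → 𝕜} {u₁ u₂ : ℝ → Fin n → 𝕜} {T : ℝ} (hT : 0 ≤ T)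
    (h₁ : IsTrajectory A B x₁ u₁) (h₂ : IsTrajectory A B x₂ u₂) (h : x₁ T = x₂ 0) :
    ∃ (x : ℝ → Fin m → 𝕜) (u : ℝ → Fin n → 𝕜), IsTrajectory A B x u ∧ x 0 = x₁ 0 ∧
      (∀ t, 0 ≤ t → x (T + t) = x₂ t) ∧
      ∀ (Q : Matrix (Fin m) (Fin m) 𝕜) (S : Matrix (Fin n) (Fin m) 𝕜) (R : Matrix (Fin n) (Fin n) 𝕜)
        (t : ℝ), 0 ≤ t →
        energy Q S R x u 0 (T + t) = energy Q S R x₁ u₁ 0 T + energy Q S R x₂ u₂ 0 t := by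
  classical
  set x : ℝ → Fin m → 𝕜 := (Set.Iic T).piecewise x₁ (fun t => x₂ (t - T)) with hx
  set u : ℝ → Fin n → 𝕜 := (Set.Iic T).piecewise u₁ (fun t => u₂ (t - T)) with hu
  have x_le : ∀ t ≤ T, x t = x₁ t := fun t ht => Set.piecewise_eq_of_mem _ _ _ ht
  have u_le : ∀ t ≤ T, u t = u₁ t := fun t ht => Set.piecewise_eq_of_mem _ _ _ ht
  have u_gt : ∀ t, T < t → u t = u₂ (t - T) := fun t ht =>
    Set.piecewise_eq_of_notMem _ _ _ (by simpa using ht)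
  -- Both branches agree at the junction, whence continuity of `x`; the input, being only $L^2$,
  -- needs no matching.
  have x_ge : ∀ t, T ≤ t → x t = x₂ (t - T) := fun t ht => by
    rcases ht.eq_or_lt with rfl | ht
    · rw [x_le _ le_rfl, h, sub_self]
    · exact Set.piecewise_eq_of_notMem _ _ _ (by simpa using ht)
  refine ⟨x, u, ⟨fun S => ?_, ?_, fun t ht => ?_⟩, x_le 0 hT, fun t ht => ?_, ?_⟩
  · refine MemLp.piecewise measurableSet_Iic ?_ ?_
    · rw [Measure.restrict_restrict measurableSet_Iic]
      have h4 : Set.Iic T ∩ Set.Icc 0 S ⊆ Set.Icc 0 T := fun s hs => ⟨hs.2.1, hs.1⟩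
      exact (h₁.memLp_input T).mono_measure (Measure.restrict_mono h4 le_rfl)
    · rw [Measure.restrict_restrict measurableSet_Iic.compl]
      have h3 := (h₂.memLp_input (S - T)).comp_measurePreserving
        ((measurePreserving_sub_right volume T).restrict_preimage measurableSet_Icc)
      have h4 : (Set.Iic T)ᶜ ∩ Set.Icc 0 S ⊆ (fun s => s - T) ⁻¹' Set.Icc 0 (S - T) := fun s hs => by
        have h5 : T < s := by simpa using hs.1
        exact ⟨by linarith, by linarith [hs.2.2]⟩
      exact MemLp.mono_measure (Measure.restrict_mono h4 le_rfl) h3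
  · have c₁ : ContinuousOn x (Set.Icc 0 T) :=
      (h₁.continuousOn_state.mono Set.Icc_subset_Ici_self).congr fun t ht => x_le t ht.2
    have c₂ : ContinuousOn x (Set.Ici T) := by
      refine ContinuousOn.congr (f := fun t => x₂ (t - T)) ?_ fun t ht => x_ge t ht
      exact h₂.continuousOn_state.comp (by fun_prop) fun t ht => by
        simpa using ht
    have := c₁.union_of_isClosed c₂ isClosed_Icc isClosed_Ici
    rwa [Set.Icc_union_Ici_eq_Ici hT] at this
  · rcases le_total t T with htT | htT
    · rw [x_le t htT, x_le 0 hT, h₁.state_eq t ht]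
      congr 1
      refine intervalIntegral.integral_congr fun s hs => ?_
      rw [Set.uIcc_of_le ht] at hs
      simp only [x_le s (hs.2.trans htT), u_le s (hs.2.trans htT)]
    · have e := integral_eq_add_of_eq_shift (f := fun s => A *ᵥ x s + B *ᵥ u s) hT
        (sub_nonneg.2 htT) (fun s hs => by rw [x_le s hs, u_le s hs])
        (fun s hs => by rw [x_ge s hs.le, u_gt s hs]) (h₁.intervalIntegrable_velocity hT)
        (h₂.intervalIntegrable_velocity (sub_nonneg.2 htT))
      rw [add_sub_cancel] at e
      rw [e, x_ge t htT, x_le 0 hT, ← add_assoc, ← h₁.state_eq T hT, h,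
        ← h₂.state_eq _ (sub_nonneg.2 htT)]
  · rw [x_ge _ (by linarith), add_sub_cancel_left]
  · intro Q S R t ht
    exact integral_eq_add_of_eq_shift hT ht (fun s hs => by rw [x_le s hs, u_le s hs])
      (fun s hs => by rw [x_ge s hs.le, u_gt s hs]) (h₁.intervalIntegrable_supplyRate Q S R hT)
      (h₂.intervalIntegrable_supplyRate Q S R ht)

/-- Along a trajectory, the quadratic form of a Hermitian matrix is the integral of its
derivative. -/
theorem quadForm_sub_eq_integral {x : ℝ → Fin m → 𝕜} {u : ℝ → Fin n → 𝕜} (h : IsTrajectory A B x u)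
    {P : Matrix (Fin m) (Fin m) 𝕜} (hP : P.IsHermitian) {T : ℝ} (hT : 0 ≤ T) :
    quadForm P (x T) - quadForm P (x 0) =
      ∫ s in (0 : ℝ)..T, 2 * RCLike.re (star (x s) ⬝ᵥ P *ᵥ (A *ᵥ x s + B *ᵥ u s)) := by
  set v : ℝ → Fin m → 𝕜 := fun s => A *ᵥ x s + B *ᵥ u s with hv
  have hvi : ∀ i, IntervalIntegrable (fun s => v s i) volume 0 T := fun i =>
    ⟨Integrable.eval (h.intervalIntegrable_velocity hT).1 i,
      Integrable.eval (h.intervalIntegrable_velocity hT).2 i⟩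
  have hvs : ∀ i, IntervalIntegrable (fun s => star (v s i)) volume 0 T := fun i => 
    ⟨(RCLike.conjCLE (K := 𝕜)).toContinuousLinearMap.integrable_comp (hvi i).1,
      (RCLike.conjCLE (K := 𝕜)).toContinuousLinearMap.integrable_comp (hvi i).2⟩
  have hxc : ∀ i, ContinuousOn (fun s => x s i) (Set.uIcc 0 T) := fun i => by
    rw [Set.uIcc_of_le hT]
    exact (continuous_apply i).comp_continuousOn
      (h.continuousOn_state.mono Set.Icc_subset_Ici_self)
  have hstar : ∀ i, ∀ t ∈ Set.Icc 0 T, star (x t i) = star (x 0 i) + ∫ s in (0 : ℝ)..t, star (v s i) := by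
    intro i t ht
    rw [h.state_apply_eq ht.1 i, star_add]
    congr 1
    exact (RCLike.conjCLE.toContinuousLinearMap.intervalIntegral_comp_comm
      ((hvi i).mono_set (Set.uIcc_subset_uIcc_left (by rwa [Set.uIcc_of_le hT])))).symm
  have hij : ∀ i j, ∫ s in (0 : ℝ)..T, (star (v s i) * x s j + star (x s i) * v s j) =
      star (x T i) * x T j - star (x 0 i) * x 0 j := fun i j =>
    integral_mul_add_mul_eq_sub (F := fun s => star (x s i)) (G := fun s => x s j) hT (hvs i) (hvi j)
      (hstar i) fun t ht => h.state_apply_eq ht.1 j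
  have hint : ∀ i j, IntervalIntegrable (fun s => star (v s i) * x s j + star (x s i) * v s j)
      volume 0 T := fun i j =>
    ((hvs i).mul_continuousOn (hxc j)).add ((hvi j).continuousOn_mul (hxc i).star)
  -- Hermitian symmetry splits the factor $2$ into $v^*Px+x^*Pv$, the form to which the entrywise
  -- product rule applies.
  have hpt : ∀ s, 2 * RCLike.re (star (x s) ⬝ᵥ P *ᵥ (v s)) =
      RCLike.re (∑ i, ∑ j, P i j * (star (v s i) * x s j + star (x s i) * v s j)) := fun s => by
    rw [two_mul]
    nth_rewrite 1 [re_dotProduct_mulVec_comm hP]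
    rw [← map_add]
    congr 1
    simp only [dotProduct, mulVec, Finset.mul_sum, ← Finset.sum_add_distrib, Pi.star_apply]
    refine Finset.sum_congr rfl fun i _ => Finset.sum_congr rfl fun j _ => ?_
    ring
  have hint' : ∀ i j, IntervalIntegrable
      (fun s => P i j * (star (v s i) * x s j + star (x s i) * v s j)) volume 0 T :=
    fun i j => (hint i j).const_mul _
  have hrow : ∀ i, IntervalIntegrable
      (fun s => ∑ j, P i j * (star (v s i) * x s j + star (x s i) * v s j)) volume 0 T := fun i => by
    simpa only [Finset.sum_fn] using IntervalIntegrable.sum Finset.univ fun j _ => hint' i j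
  have hsum : IntervalIntegrable
      (fun s => ∑ i, ∑ j, P i j * (star (v s i) * x s j + star (x s i) * v s j)) volume 0 T := by
    simpa only [Finset.sum_fn] using IntervalIntegrable.sum Finset.univ fun i _ => hrow i
  have hre := RCLike.reCLM.intervalIntegral_comp_comm hsum
  simp only [RCLike.reCLM_apply] at hre
  rw [intervalIntegral.integral_congr fun s _ => hpt s, hre,
    intervalIntegral.integral_finsetSum fun i _ => hrow i]
  simp only [intervalIntegral.integral_finsetSum fun j _ => hint' _ j,
    intervalIntegral.integral_const_mul, hij, quadForm, ← map_sub]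
  congr 1
  simp only [dotProduct, mulVec, Finset.mul_sum, ← Finset.sum_sub_distrib, Pi.star_apply]
  refine Finset.sum_congr rfl fun i _ => Finset.sum_congr rfl fun j _ => ?_
  ring

end IsTrajectory

end Trajectories

end LTI

namespace LTI

/-! ### Passage from $\mathbb K$ to $\mathbb C$, where Fourier series and eigenvalues are used. -/

section Complexification

variable {𝕜 : Type*} [RCLike 𝕜]

variable (𝕜) in
/-- The canonical embedding of `ℝ` or `ℂ` into `ℂ`. -/
noncomputable def complexify : 𝕜 →+* ℂ where
  toFun := RCLike.map 𝕜 ℂ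
  map_one' := by simp
  map_zero' := by simp
  map_add' z w := by
    apply Complex.ext <;> simp
  map_mul' z w := by
    apply Complex.ext <;> simp [RCLike.mul_re, RCLike.mul_im]

theorem complexify_apply (z : 𝕜) :
    complexify 𝕜 z = (RCLike.re z : ℂ) + (RCLike.im z : ℂ) * Complex.I := by
  simp [complexify]

theorem complexify_re (z : 𝕜) : (complexify 𝕜 z).re = RCLike.re z := by
  simp [complexify_apply]

theorem complexify_im (z : 𝕜) : (complexify 𝕜 z).im = RCLike.im z := by
  simp [complexify_apply]

theorem complexify_star (z : 𝕜) : complexify 𝕜 (star z) = star (complexify 𝕜 z) := by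
  apply Complex.ext <;> simp [complexify_re, complexify_im]

theorem continuous_complexify : Continuous (complexify 𝕜) :=
  (RCLike.map 𝕜 ℂ).continuous

variable {ι κ : Type*}

theorem toComplex_mulVec [Fintype κ] (M : Matrix ι κ 𝕜) (z : κ → 𝕜) :
    toComplex M *ᵥ (complexify 𝕜 ∘ z) = complexify 𝕜 ∘ (M *ᵥ z) := by
  ext i
  exact (RingHom.map_mulVec (complexify 𝕜) M z i).symm

theorem complexify_star_dotProduct [Fintype ι] (z w : ι → 𝕜) :
    star (complexify 𝕜 ∘ z) ⬝ᵥ (complexify 𝕜 ∘ w) = complexify 𝕜 (star z ⬝ᵥ w) := by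
  simp only [dotProduct, map_sum, map_mul, Pi.star_apply, complexify_star, Function.comp_apply]

theorem quadForm_toComplex [Fintype ι] (M : Matrix ι ι 𝕜) (z : ι → 𝕜) :
    quadForm (toComplex M) (complexify 𝕜 ∘ z) = quadForm M z := by
  rw [quadForm, toComplex_mulVec, complexify_star_dotProduct]
  exact complexify_re _

theorem toComplex_conjTranspose (M : Matrix ι κ 𝕜) : toComplex Mᴴ = (toComplex M)ᴴ := by
  ext i j
  exact complexify_star _

theorem IsTrajectory.complexify {m n : ℕ} {A : Matrix (Fin m) (Fin m) 𝕜}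
    {B : Matrix (Fin m) (Fin n) 𝕜} {x : ℝ → Fin m → 𝕜} {u : ℝ → Fin n → 𝕜}
    (h : IsTrajectory A B x u) :
    IsTrajectory (toComplex A) (toComplex B) (fun t => complexify 𝕜 ∘ x t)
      (fun t => complexify 𝕜 ∘ u t) where
  memLp_input T := memLp_pi_iff.2 fun i =>
    (RCLike.map 𝕜 ℂ).comp_memLp' (memLp_pi_iff.1 (h.memLp_input T) i)
  continuousOn_state := by
    refine continuousOn_pi.2 fun i => ?_
    exact continuous_complexify.comp_continuousOn
      ((continuous_apply i).comp_continuousOn h.continuousOn_state)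
  state_eq t ht := by
    let L : (Fin m → 𝕜) →L[ℝ] (Fin m → ℂ) :=
      ContinuousLinearMap.pi fun i => (RCLike.map 𝕜 ℂ).comp (ContinuousLinearMap.proj i)
    have hL : ∀ z, L z = LTI.complexify 𝕜 ∘ z := fun z => rfl
    have e : ∀ s, toComplex A *ᵥ (LTI.complexify 𝕜 ∘ x s) + toComplex B *ᵥ (LTI.complexify 𝕜 ∘ u s) =
        L (A *ᵥ x s + B *ᵥ u s) := fun s => by
      rw [map_add, hL, hL, toComplex_mulVec, toComplex_mulVec]
    simp only [e]
    rw [L.intervalIntegral_comp_comm (h.intervalIntegrable_velocity ht), ← hL, ← hL, ← map_add,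
      ← h.state_eq t ht]

end Complexification

/-! ### Parseval's identity and the energy of loops. -/

section Fourier

/-- Parseval's identity for two functions on an interval. -/
theorem hasSum_star_mul_fourierCoeffOn {a b : ℝ} {f g : ℝ → ℂ} (hab : a < b)
    (hf : MemLp f 2 (volume.restrict (Set.Ioc a b)))
    (hg : MemLp g 2 (volume.restrict (Set.Ioc a b))) :
    HasSum (fun k => star (fourierCoeffOn hab f k) * fourierCoeffOn hab g k)
      ((b - a)⁻¹ • ∫ s in a..b, star (f s) * g s) := by
  have := Fact.mk (by linarith : 0 < b - a)
  rw [← add_sub_cancel a b] at hf hg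
  -- Haar measure on the circle of length $b-a$ is normalized, whence the factor $(b-a)^{-1}$.
  have h := hf.memLp_liftIoc.haarAddCircle
  have k := hg.memLp_liftIoc.haarAddCircle
  have key := (fourierBasis (T := b - a)).hasSum_inner_mul_inner h.toLp k.toLp
  have e1 : ∀ i, inner ℂ h.toLp (fourierBasis (T := b - a) i) *
      inner ℂ (fourierBasis (T := b - a) i) k.toLp =
        star (fourierCoeffOn hab f i) * fourierCoeffOn hab g i := fun i => by
    rw [← inner_conj_symm, ← HilbertBasis.repr_apply_apply, ← HilbertBasis.repr_apply_apply,
      fourierBasis_repr, fourierBasis_repr, fourierCoeff_congr_ae h.coeFn_toLp,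
      fourierCoeff_congr_ae k.coeFn_toLp]
    rfl
  have e2 : inner ℂ h.toLp k.toLp = (b - a)⁻¹ • ∫ s in a..b, star (f s) * g s := by
    have e : ∀ᵐ t : AddCircle (b - a) ∂AddCircle.haarAddCircle,
        inner ℂ ((h.toLp : Lp ℂ 2 _) t) ((k.toLp : Lp ℂ 2 _) t) =
        AddCircle.liftIoc (b - a) a (fun s => star (f s) * g s) t := by
      filter_upwards [h.coeFn_toLp, k.coeFn_toLp] with t ht kt
      rw [ht, kt, RCLike.inner_apply, mul_comm]
      rfl
    rw [L2.inner_def, integral_congr_ae e, AddCircle.integral_haarAddCircle,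
      AddCircle.integral_liftIoc_eq_intervalIntegral, add_sub_cancel]
  rw [← e2]
  exact key.congr_fun fun i => (e1 i).symm

/-- The exceptional frequencies come from the imaginary roots of the characteristic polynomial. -/
theorem det_smul_one_sub_eq_zero_finite {m : ℕ} (A : Matrix (Fin m) (Fin m) ℂ) :
    {ω : ℝ | ((Complex.I * ω) • (1 : Matrix (Fin m) (Fin m) ℂ) - A).det = 0}.Finite := by
  have h : {s : ℂ | (s • (1 : Matrix (Fin m) (Fin m) ℂ) - A).det = 0} = {s | A.charpoly.IsRoot s} := by
    ext s
    rw [Set.mem_ofPred_eq, Set.mem_ofPred_eq, Polynomial.IsRoot, eval_charpoly, scalar_apply,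
      smul_one_eq_diagonal]
  have hfin := Polynomial.finite_setOfPred_isRoot (A.charpoly_monic.ne_zero)
  rw [← h] at hfin
  exact hfin.preimage (f := fun ω : ℝ => Complex.I * ω) (fun x _ y _ hxy => by
    simpa using hxy)

/-- The energy supplied along a loop at the origin is nonnegative if the frequency domain inequality
holds. -/
theorem integral_quadForm_nonneg_of_loop {m n : ℕ} {A : Matrix (Fin m) (Fin m) ℂ}
    {B : Matrix (Fin m) (Fin n) ℂ} {M : Matrix (Fin m ⊕ Fin n) (Fin m ⊕ Fin n) ℂ}
    (hM : ∀ ω : ℝ, ((Complex.I * ω) • (1 : Matrix (Fin m) (Fin m) ℂ) - A).det ≠ 0 →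
      ∀ (x : Fin m → ℂ) (u : Fin n → ℂ), (Complex.I * ω) • x = A *ᵥ x + B *ᵥ u →
        0 ≤ quadForm M (Sum.elim x u))
    {x : ℝ → Fin m → ℂ} {u : ℝ → Fin n → ℂ} (h : IsTrajectory A B x u) {T : ℝ} (hT : 0 < T)
    (h0 : x 0 = 0) (hxT : x T = 0) :
    0 ≤ ∫ s in (0 : ℝ)..T, quadForm M (Sum.elim (x s) (u s)) := by
  -- The frequencies $2\pi k/T$ may meet eigenvalues of $A$. Each $k$ excludes finitely many shifts
  -- $\theta$, so a common admissible shift exists.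
  obtain ⟨θ, hθ⟩ : ∃ θ : ℝ, ∀ k : ℤ,
      ((Complex.I * (θ + 2 * Real.pi * k / T : ℝ)) • (1 : Matrix (Fin m) (Fin m) ℂ) - A).det ≠ 0 := by
    have hc : (⋃ k : ℤ, (fun θ : ℝ => θ + 2 * Real.pi * k / T) ⁻¹'
        {ω : ℝ | ((Complex.I * ω) • (1 : Matrix (Fin m) (Fin m) ℂ) - A).det = 0}).Countable :=
      Set.countable_iUnion fun k => ((det_smul_one_sub_eq_zero_finite A).countable).preimage_of_injOn
        (fun a _ b _ hab => by simpa using hab)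
    obtain ⟨θ, hθ⟩ := (hc.dense_compl ℝ).nonempty
    refine ⟨θ, fun k hk => hθ (Set.mem_iUnion.2 ⟨k, hk⟩)⟩
  set ω : ℤ → ℝ := fun k => θ + 2 * Real.pi * k / T with hω
  set z : ℝ → Fin m ⊕ Fin n → ℂ := fun s => Sum.elim (x s) (u s) with hz
  set E : ℝ → ℝ → ℂ := fun w s => Complex.exp (-(Complex.I * w) * s) with hE
  have hEc : ∀ w, Continuous (E w) := fun w => by fun_prop
  have hzmem : ∀ i, MemLp (fun s => z s i) 2 (volume.restrict (Set.Ioc 0 T)) := fun i =>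
    (memLp_pi_iff.1 (h.memLp_pair T) i).mono_measure
      (Measure.restrict_mono Set.Ioc_subset_Icc_self le_rfl)
  have hzint : ∀ i, IntervalIntegrable (fun s => z s i) volume 0 T := fun i => by
    rw [intervalIntegrable_iff_integrableOn_Ioc_of_le hT.le]
    exact (hzmem i).integrable (by norm_num)
  have hEz : ∀ w i, IntervalIntegrable (fun s => E w s * z s i) volume 0 T := fun w i =>
    (hzint i).continuousOn_mul (hEc w).continuousOn
  set c : ℝ → Fin m ⊕ Fin n → ℂ := fun w i => ∫ s in (0 : ℝ)..T, E w s * z s i with hc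
  -- Integration by parts against $e^{-iws}$. The boundary terms vanish for every real $w$ because
  -- $x(0)=x(T)=0$, so no periodicity of the exponential is needed.
  have hcdyn : ∀ w : ℝ, (Complex.I * w) • (fun i => c w (Sum.inl i)) =
      A *ᵥ (fun i => c w (Sum.inl i)) + B *ᵥ (fun i => c w (Sum.inr i)) := by
    intro w
    ext i
    have hder : ∀ s, HasDerivAt (E w) (-(Complex.I * w) * E w s) s := fun s => by
      have h1 : HasDerivAt (fun s : ℝ => -(Complex.I * w) * (s : ℂ)) (-(Complex.I * w)) s := by
        simpa using (Complex.ofRealCLM.hasDerivAt (x := s)).const_mul (-(Complex.I * w))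
      exact h1.cexp.congr_deriv (mul_comm _ _)
    have hdc : Continuous fun s => -(Complex.I * w) * E w s := continuous_const.mul (hEc w)
    have hv : IntervalIntegrable (fun s => (A *ᵥ x s + B *ᵥ u s) i) volume 0 T :=
      ⟨Integrable.eval (h.intervalIntegrable_velocity hT.le).1 i,
        Integrable.eval (h.intervalIntegrable_velocity hT.le).2 i⟩
    have hparts := integral_mul_add_mul_eq_sub (F := E w) (G := fun s => x s i) hT.le
      (hdc.intervalIntegrable 0 T) hv
      (fun t _ => by
        rw [intervalIntegral.integral_eq_sub_of_hasDerivAt (fun s _ => hder s)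
          (hdc.intervalIntegrable 0 t)]
        ring)
      (fun t ht => h.state_apply_eq ht.1 i)
    simp only [h0, hxT, Pi.zero_apply, mul_zero, sub_zero] at hparts
    have e1 : ∀ s, -(Complex.I * w) * E w s * x s i + E w s * (A *ᵥ x s + B *ᵥ u s) i =
        -(Complex.I * w) * (E w s * z s (Sum.inl i)) +
          ((∑ j, A i j * (E w s * z s (Sum.inl j))) +
            ∑ j, B i j * (E w s * z s (Sum.inr j))) := fun s => by
      simp only [hz, Sum.elim_inl, Sum.elim_inr, Pi.add_apply, mulVec, dotProduct, mul_add,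
        Finset.mul_sum]
      congr 1
      · ring
      · congr 1 <;> exact Finset.sum_congr rfl fun j _ => by ring
    have iA : IntervalIntegrable (fun s => ∑ j, A i j * (E w s * z s (Sum.inl j))) volume 0 T := by
      simpa only [Finset.sum_fn] using
        IntervalIntegrable.sum Finset.univ fun j _ => (hEz w (Sum.inl j)).const_mul (A i j)
    have iB : IntervalIntegrable (fun s => ∑ j, B i j * (E w s * z s (Sum.inr j))) volume 0 T := by
      simpa only [Finset.sum_fn] using
        IntervalIntegrable.sum Finset.univ fun j _ => (hEz w (Sum.inr j)).const_mul (B i j)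
    rw [intervalIntegral.integral_congr fun s _ => e1 s,
      intervalIntegral.integral_add ((hEz w _).const_mul _) (iA.add iB),
      intervalIntegral.integral_add iA iB,
      intervalIntegral.integral_finsetSum fun j _ => (hEz w _).const_mul _,
      intervalIntegral.integral_finsetSum fun j _ => (hEz w _).const_mul _] at hparts
    simp only [intervalIntegral.integral_const_mul] at hparts
    simp only [Pi.smul_apply, Pi.add_apply, mulVec, dotProduct, smul_eq_mul, hc]
    linear_combination -hparts
  -- Modulation by $e^{-i\theta s}$ shifts the frequencies by $\theta$; having modulus one, it
  -- cancels from the products in Parseval's identity.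
  have hcoef : ∀ k i, fourierCoeffOn hT (fun s => E θ s * z s i) k = (T⁻¹ : ℂ) * c (ω k) i := by
    intro k i
    rw [fourierCoeffOn_eq_integral, sub_zero, one_div, Complex.real_smul, Complex.ofReal_inv]
    congr 1
    refine intervalIntegral.integral_congr fun s _ => ?_
    simp only [hE, smul_eq_mul, fourier_coe_apply, ← mul_assoc, ← Complex.exp_add]
    congr 2
    simp only [hω]
    push_cast
    field_simp
    ring
  have hpars : ∀ i j, HasSum (fun k => star (fourierCoeffOn hT (fun s => E θ s * z s i) k) *
      (M i j * fourierCoeffOn hT (fun s => E θ s * z s j) k))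
      (T⁻¹ • ∫ s in Set.Ioc 0 T, star (z s i) * (M i j * z s j)) := by
    intro i j
    have hEn : ∀ s, star (E θ s) * E θ s = 1 := fun s => by
      simp only [hE, Complex.star_def, ← Complex.exp_conj, ← Complex.exp_add]
      rw [← Complex.exp_zero]
      congr 1
      simp
    have hmem : ∀ i, MemLp (fun s => E θ s * z s i) 2 (volume.restrict (Set.Ioc 0 T)) := fun i => by
      refine (hzmem i).of_le ((hEc θ).aestronglyMeasurable.mul (hzmem i).1)
        (ae_of_all _ fun s => ?_)
      have : ‖E θ s‖ = 1 := by
        simp [hE, Complex.norm_exp]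
      rw [norm_mul, this, one_mul]
    have key := (hasSum_star_mul_fourierCoeffOn hT (hmem i) (hmem j)).mul_left (M i j)
    rw [sub_zero, mul_smul_comm, ← intervalIntegral.integral_const_mul,
      intervalIntegral.integral_of_le hT.le] at key
    have e : ∀ s, M i j * (star (E θ s * z s i) * (E θ s * z s j)) =
        star (z s i) * (M i j * z s j) := fun s => by
      rw [star_mul']
      linear_combination (M i j * star (z s i) * z s j) * hEn s
    simp only [e] at key
    exact key.congr_fun fun k => by ring
  have hsum := hasSum_sum (s := Finset.univ) fun i _ =>
    hasSum_sum (s := Finset.univ) fun j _ => (hpars i j).mapL Complex.reCLM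
  have hterm : ∀ k, 0 ≤ ∑ i, ∑ j, Complex.reCLM (star (fourierCoeffOn hT (fun s => E θ s * z s i) k) *
      (M i j * fourierCoeffOn hT (fun s => E θ s * z s j) k)) := fun k => by
    have e : (fun i => fourierCoeffOn hT (fun s => E θ s * z s i) k) =
        (T⁻¹ : ℂ) • Sum.elim (fun i => c (ω k) (Sum.inl i)) (fun i => c (ω k) (Sum.inr i)) := by
      ext i
      rw [hcoef]
      cases i <;> rfl
    have hq := quadForm_eq_sum M (fun i => fourierCoeffOn hT (fun s => E θ s * z s i) k)
    refine le_of_le_of_eq ?_ hq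
    rw [e, quadForm_smul]
    exact mul_nonneg (by positivity) (hM (ω k) (hθ k) _ _ (hcdyn (ω k)))
  have hnn := hsum.nonneg hterm
  have hzL : MemLp z 2 (volume.restrict (Set.Ioc 0 T)) := memLp_pi_iff.2 hzmem
  rw [intervalIntegral.integral_of_le hT.le, integral_quadForm M hzL]
  simp only [map_smul, smul_eq_mul, ← Finset.mul_sum] at hnn
  exact nonneg_of_mul_nonneg_right hnn (by positivity)

end Fourier

end LTI

/-! ### The frequency domain inequality and loops at the origin. -/

namespace LTI

variable {𝕜 : Type*} [RCLike 𝕜] {m n : ℕ}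
  {A : Matrix (Fin m) (Fin m) 𝕜} {B : Matrix (Fin m) (Fin n) 𝕜}
  {Q : Matrix (Fin m) (Fin m) 𝕜} {S : Matrix (Fin n) (Fin m) 𝕜} {R : Matrix (Fin n) (Fin n) 𝕜}

theorem quadForm_conjTranspose_mul_mul {ι κ : Type*} [Fintype ι] [Fintype κ] (M : Matrix ι ι 𝕜)
    (N : Matrix ι κ 𝕜) (z : κ → 𝕜) : quadForm (Nᴴ * M * N) z = quadForm M (N *ᵥ z) := by
  rw [quadForm, quadForm, star_mulVec, ← mulVec_mulVec, ← mulVec_mulVec, dotProduct_mulVec]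

/-- The equation determines $x=(sI-A)^{-1}Bu$, so the form of $\Pi$ at $u$ becomes that of $M$ at
$(x,u)$. -/
theorem resolventColumn_mulVec {s : ℂ}
    (hs : (s • (1 : Matrix (Fin m) (Fin m) ℂ) - toComplex A).det ≠ 0) {x : Fin m → ℂ}
    {u : Fin n → ℂ} (h : s • x = toComplex A *ᵥ x + toComplex B *ᵥ u) :
    resolventColumn A B s *ᵥ u = Sum.elim x u := by
  have h1 : (s • (1 : Matrix (Fin m) (Fin m) ℂ) - toComplex A) *ᵥ x = toComplex B *ᵥ u := by
    rw [sub_mulVec, smul_mulVec, one_mulVec, h, add_sub_cancel_left]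
  rw [resolventColumn, fromRows_mulVec, one_mulVec, ← mulVec_mulVec, ← h1, mulVec_mulVec,
    nonsing_inv_mul _ (isUnit_iff_ne_zero.2 hs), one_mulVec]

/-- Under the frequency domain inequality, the energy supplied along a loop at the origin is
nonnegative. -/
theorem energy_nonneg_of_loop (hfdi : FrequencyInequality A B Q S R) {x : ℝ → Fin m → 𝕜}
    {u : ℝ → Fin n → 𝕜} (h : IsTrajectory A B x u) {T : ℝ} (hT : 0 ≤ T) (h0 : x 0 = 0)
    (hxT : x T = 0) : 0 ≤ energy Q S R x u 0 T := by
  rcases hT.eq_or_lt with rfl | hT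
  · simp [energy]
  have key := integral_quadForm_nonneg_of_loop (M := toComplex (fromBlocks Q Sᴴ S R))
    (fun ω hω x u hxu => by
      have hp := hfdi ω hω
      -- On the imaginary axis both resolvent columns in $\Pi$ coincide, so $\Pi=N^*MN$.
      have hs : star (-(Complex.I * (ω : ℂ))) = Complex.I * ω := by simp
      rw [popov, hs] at hp
      have := (posSemidef_iff_quadForm hp.1).1 hp u
      rwa [quadForm_conjTranspose_mul_mul, resolventColumn_mulVec hω hxu] at this)
    h.complexify hT (by simp [h0, Function.comp_def]; rfl) (by simp [hxT, Function.comp_def]; rfl)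
  simpa only [energy, supplyRate_eq_quadForm, ← Sum.comp_elim, quadForm_toComplex] using key

theorem energy_zero (T : ℝ) : energy Q S R (0 : ℝ → Fin m → 𝕜) (0 : ℝ → Fin n → 𝕜) 0 T = 0 := by
  simp [energy, supplyRate]

/-! ### Operations on the energies of trajectories from the origin. -/

section SupplySet

theorem supplySet_nonempty (hc : Controllable A B) (x₀ : Fin m → 𝕜) :
    (supplySet A B Q S R x₀).Nonempty := by
  obtain ⟨x, u, T, hT, h, h0, hxT⟩ := hc 0 x₀
  exact ⟨_, x, u, T, hT, h, h0, hxT, rfl⟩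

theorem zero_mem_supplySet : (0 : ℝ) ∈ supplySet A B Q S R 0 :=
  ⟨0, 0, 0, le_rfl, IsTrajectory.zero, rfl, rfl, by simp [energy]⟩

theorem add_energy_mem_supplySet {e : ℝ} {x : ℝ → Fin m → 𝕜} {u : ℝ → Fin n → 𝕜}
    (h : IsTrajectory A B x u) (he : e ∈ supplySet A B Q S R (x 0)) {t : ℝ} (ht : 0 ≤ t) :
    e + energy Q S R x u 0 t ∈ supplySet A B Q S R (x t) := by
  obtain ⟨y, v, T, hT, k, k0, kT, rfl⟩ := he
  obtain ⟨z, w, hz, z0, hzt, hE⟩ := k.exists_concat hT h kT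
  exact ⟨z, w, T + t, by linarith, hz, z0.trans k0, hzt t ht, (hE Q S R t ht).symm⟩

/-- A fixed return from `x₀` to $0$ closes every competitor into a loop of nonnegative energy. -/
theorem bddBelow_supplySet (hc : Controllable A B) (hfdi : FrequencyInequality A B Q S R)
    (x₀ : Fin m → 𝕜) : BddBelow (supplySet A B Q S R x₀) := by
  obtain ⟨x, u, T, hT, h, h0, hxT⟩ := hc x₀ 0
  refine ⟨-energy Q S R x u 0 T, fun e he => ?_⟩
  rw [← h0] at he
  have h1 := add_energy_mem_supplySet h he hT
  rw [hxT] at h1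
  obtain ⟨y, v, T', hT', k, k0, kT, hE⟩ := h1
  have := energy_nonneg_of_loop hfdi k hT' k0 kT
  linarith

/-- A trajectory from the origin can be delayed. -/
theorem exists_delayed {e : ℝ} {x₀ : Fin m → 𝕜} (he : e ∈ supplySet A B Q S R x₀) :
    ∃ T₀, 0 ≤ T₀ ∧ ∀ T, T₀ ≤ T → ∃ (x : ℝ → Fin m → 𝕜) (u : ℝ → Fin n → 𝕜), IsTrajectory A B x u ∧
      x 0 = 0 ∧ x T = x₀ ∧ energy Q S R x u 0 T = e := by
  obtain ⟨y, v, T₀, hT₀, k, k0, kT, rfl⟩ := he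
  refine ⟨T₀, hT₀, fun T hT => ?_⟩
  -- Resting at the origin for time `T - T₀` costs nothing.
  obtain ⟨z, w, hz, z0, hzt, hE⟩ :=
    (IsTrajectory.zero (A := A) (B := B)).exists_concat (sub_nonneg.2 hT) k k0.symm
  have h1 := hzt T₀ hT₀
  have h2 := hE Q S R T₀ hT₀
  rw [sub_add_cancel] at h1 h2
  rw [energy_zero, zero_add] at h2
  exact ⟨z, w, hz, z0, h1.trans kT, h2⟩

theorem smul_mem_supplySet {e : ℝ} {x₀ : Fin m → 𝕜} (he : e ∈ supplySet A B Q S R x₀) (c : 𝕜) :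
    ‖c‖ ^ 2 * e ∈ supplySet A B Q S R (c • x₀) := by
  obtain ⟨y, v, T, hT, k, k0, kT, rfl⟩ := he
  refine ⟨c • y, c • v, T, hT, k.smul c, by simp [k0], by simp [kT], ?_⟩
  rw [energy, energy, ← intervalIntegral.integral_const_mul]
  refine intervalIntegral.integral_congr fun s _ => ?_
  simp only [supplyRate_eq_quadForm, ← quadForm_smul, Pi.smul_apply]
  congr 1
  ext i
  cases i <;> rfl

/-- Delay both trajectories to a common final time and superpose: the energy is quadratic in `t`.
The cross term `c` does not depend on `t` and is read off at $t=1$. -/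
theorem exists_smul_add_mem_supplySet {e₁ e₂ : ℝ} {x₁ x₂ : Fin m → 𝕜}
    (h₁ : e₁ ∈ supplySet A B Q S R x₁) (h₂ : e₂ ∈ supplySet A B Q S R x₂) :
    ∃ c : ℝ, ∀ t : ℝ, t ^ 2 * e₁ + t * c + e₂ ∈ supplySet A B Q S R (t • x₁ + x₂) := by
  obtain ⟨T₁, hT₁, H₁⟩ := exists_delayed h₁
  obtain ⟨T₂, -, H₂⟩ := exists_delayed h₂
  set T := max T₁ T₂
  have hT : 0 ≤ T := hT₁.trans (le_max_left _ _)
  obtain ⟨x, u, k, k0, kT, kE⟩ := H₁ T (le_max_left _ _)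
  obtain ⟨y, v, l, l0, lT, lE⟩ := H₂ T (le_max_right _ _)
  set M := fromBlocks Q Sᴴ S R
  have hadd := quadForm_smul_add M
  refine ⟨energy Q S R (x + y) (u + v) 0 T - e₁ - e₂, fun t =>
    ⟨(t : 𝕜) • x + y, (t : 𝕜) • u + v, T, hT, (k.smul _).add l, by simp [k0, l0], ?_, ?_⟩⟩
  · rw [RCLike.real_smul_eq_coe_smul (K := 𝕜) t]
    simp [kT, lT]
  · have i₁ := k.intervalIntegrable_supplyRate Q S R hT
    have i₂ := l.intervalIntegrable_supplyRate Q S R hT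
    have i₃ := (k.add l).intervalIntegrable_supplyRate Q S R hT
    rw [← kE, ← lE]
    simp only [energy]
    rw [← intervalIntegral.integral_sub i₃ i₁, ← intervalIntegral.integral_sub (i₃.sub i₁) i₂,
      ← intervalIntegral.integral_const_mul, ← intervalIntegral.integral_const_mul,
      ← intervalIntegral.integral_add (i₁.const_mul _) (((i₃.sub i₁).sub i₂).const_mul _),
      ← intervalIntegral.integral_add
        ((i₁.const_mul _).add (((i₃.sub i₁).sub i₂).const_mul _)) i₂]
    refine intervalIntegral.integral_congr fun s _ => ?_
    have e1 : ∀ r : ℝ, Sum.elim (((r : 𝕜) • x + y) s) (((r : 𝕜) • u + v) s) =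
        r • Sum.elim (x s) (u s) + Sum.elim (y s) (v s) := fun r => by
      rw [RCLike.real_smul_eq_coe_smul (K := 𝕜) r]
      ext i
      cases i <;> rfl
    have e2 := e1 1
    simp only [RCLike.ofReal_one, one_smul] at e2
    have e3 := hadd 1 (Sum.elim (x s) (u s)) (Sum.elim (y s) (v s))
    rw [one_smul] at e3
    simp only [supplyRate_eq_quadForm]
    rw [e1, hadd, e2, e3]
    ring

end SupplySet

/-! ### The required supply is a quadratic form. -/

section RequiredSupply

variable (A B Q S R) in
/-- The required supply. -/
noncomputable def requiredSupply (x₀ : Fin m → 𝕜) : ℝ := sInf (supplySet A B Q S R x₀)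

theorem isGLB_requiredSupply (hc : Controllable A B) (hfdi : FrequencyInequality A B Q S R)
    (x₀ : Fin m → 𝕜) : IsGLB (supplySet A B Q S R x₀) (requiredSupply A B Q S R x₀) :=
  isGLB_csInf (supplySet_nonempty hc x₀) (bddBelow_supplySet hc hfdi x₀)

theorem requiredSupply_zero (hc : Controllable A B) (hfdi : FrequencyInequality A B Q S R) :
    requiredSupply A B Q S R 0 = 0 := by
  refine (isGLB_requiredSupply hc hfdi 0).unique ⟨fun e he => ?_, fun b hb => hb zero_mem_supplySet⟩
  obtain ⟨y, v, T, hT, k, k0, kT, rfl⟩ := he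
  exact energy_nonneg_of_loop hfdi k hT k0 kT

theorem requiredSupply_smul (hc : Controllable A B) (hfdi : FrequencyInequality A B Q S R)
    (c : 𝕜) (x : Fin m → 𝕜) :
    requiredSupply A B Q S R (c • x) = ‖c‖ ^ 2 * requiredSupply A B Q S R x := by
  by_cases hc0 : c = 0
  · simp [hc0, requiredSupply_zero hc hfdi]
  have hle : ∀ (d : 𝕜) (_ : d ≠ 0) (y : Fin m → 𝕜),
      requiredSupply A B Q S R (d • y) ≤ ‖d‖ ^ 2 * requiredSupply A B Q S R y := fun d hd y => by
    have hpos : 0 < ‖d‖ ^ 2 := by positivity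
    rw [← div_le_iff₀' hpos]
    refine (isGLB_requiredSupply hc hfdi y).2 fun e he => ?_
    rw [div_le_iff₀' hpos]
    exact (isGLB_requiredSupply hc hfdi _).1 (smul_mem_supplySet he d)
  refine le_antisymm (hle c hc0 x) ?_
  have h := hle c⁻¹ (inv_ne_zero hc0) (c • x)
  rw [smul_smul, inv_mul_cancel₀ hc0, one_smul, norm_inv, inv_pow] at h
  have hpos : 0 < ‖c‖ ^ 2 := by positivity
  rwa [← div_eq_inv_mul, le_div_iff₀' hpos] at h

/-- In `exists_smul_add_mem_supplySet` the cross terms at $t=\pm1$ cancel, giving $\le$; the same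
inequality for $x+y$, $x-y$ together with homogeneity gives $\ge$. -/
theorem requiredSupply_parallelogram (hc : Controllable A B)
    (hfdi : FrequencyInequality A B Q S R) (x y : Fin m → 𝕜) :
    requiredSupply A B Q S R (x + y) + requiredSupply A B Q S R (x - y) =
      2 * requiredSupply A B Q S R x + 2 * requiredSupply A B Q S R y := by
  have hglb := isGLB_requiredSupply hc hfdi (Q := Q) (S := S) (R := R)
  have hsmul := requiredSupply_smul hc hfdi (Q := Q) (S := S) (R := R)
  have hle : ∀ x y, requiredSupply A B Q S R (x + y) + requiredSupply A B Q S R (x - y) ≤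
      2 * requiredSupply A B Q S R x + 2 * requiredSupply A B Q S R y := fun x y => by
    set v := requiredSupply A B Q S R (x + y) + requiredSupply A B Q S R (x - y) with hv
    have h : ∀ e₁ ∈ supplySet A B Q S R x, ∀ e₂ ∈ supplySet A B Q S R y, v ≤ 2 * e₁ + 2 * e₂ := by
      intro e₁ h₁ e₂ h₂
      obtain ⟨c, hcm⟩ := exists_smul_add_mem_supplySet h₁ h₂
      have a1 := (hglb _).1 (hcm 1)
      have a2 := (hglb _).1 (hcm (-1))
      have a3 : (-1 : ℝ) • x + y = (-1 : 𝕜) • (x - y) := by simp [neg_add_eq_sub]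
      rw [one_smul] at a1
      rw [a3, hsmul, norm_neg, norm_one] at a2
      linarith
    have h' : ∀ e₁ ∈ supplySet A B Q S R x, (v - 2 * e₁) / 2 ≤ requiredSupply A B Q S R y :=
      fun e₁ h₁ => (hglb y).2 fun e₂ h₂ => by linarith [h e₁ h₁ e₂ h₂]
    have h'' : (v - 2 * requiredSupply A B Q S R y) / 2 ≤ requiredSupply A B Q S R x :=
      (hglb x).2 fun e₁ h₁ => by linarith [h' e₁ h₁]
    linarith
  refine le_antisymm (hle x y) ?_
  have h := hle (x + y) (x - y)
  rw [show x + y + (x - y) = (2 : 𝕜) • x by rw [two_smul]; abel,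
    show x + y - (x - y) = (2 : 𝕜) • y by rw [two_smul]; abel, hsmul, hsmul, RCLike.norm_ofNat] at h
  linarith

theorem exists_isRequiredSupplyMatrix (hc : Controllable A B)
    (hfdi : FrequencyInequality A B Q S R) : ∃ P, IsRequiredSupplyMatrix A B Q S R P := by
  have hglb := isGLB_requiredSupply hc hfdi (Q := Q) (S := S) (R := R)
  obtain ⟨P, hP, h⟩ := exists_isHermitian_quadForm_eq (requiredSupply_parallelogram hc hfdi)
    (requiredSupply_smul hc hfdi) (fun x y => by
      obtain ⟨e₁, h₁⟩ := supplySet_nonempty hc x (Q := Q) (S := S) (R := R)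
      obtain ⟨e₂, h₂⟩ := supplySet_nonempty hc y (Q := Q) (S := S) (R := R)
      obtain ⟨c, hcm⟩ := exists_smul_add_mem_supplySet h₁ h₂
      refine ⟨|e₁| + |c| + e₂, fun t ht => ((hglb _).1 (hcm t)).trans ?_⟩
      have a1 : t ^ 2 * e₁ ≤ |e₁| := (mul_le_mul_of_nonneg_left (le_abs_self e₁) (sq_nonneg t)).trans
        (mul_le_of_le_one_left (abs_nonneg _) (pow_le_one₀ ht.1 ht.2))
      have a2 : t * c ≤ |c| := (mul_le_mul_of_nonneg_left (le_abs_self c) ht.1).trans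
        (mul_le_of_le_one_left (abs_nonneg _) ht.2)
      linarith)
  refine ⟨P, hP, fun x₀ => ?_⟩
  have := hglb x₀
  rwa [← h] at this

end RequiredSupply

/-! ### Dissipation inequality, linear matrix inequality, extremality and semidefiniteness. -/

section Dissipation

theorem isHermitian_fromBlocks_supply (hQ : Q.IsHermitian) (hR : R.IsHermitian) :
    (fromBlocks Q Sᴴ S R).IsHermitian :=
  hQ.fromBlocks (conjTranspose_conjTranspose S) hR

theorem isHermitian_lmi (hQ : Q.IsHermitian) (hR : R.IsHermitian) {P : Matrix (Fin m) (Fin m) 𝕜}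
    (hP : P.IsHermitian) : (lmi A B Q S R P).IsHermitian := by
  refine IsHermitian.sub (IsHermitian.fromBlocks (isHermitian_add_transpose_self _) ?_
    isHermitian_zero) (isHermitian_fromBlocks_supply hQ hR)
  rw [conjTranspose_mul, hP.eq]

/-- The form of $-\Lambda(P)$ is the dissipation rate: supply minus the derivative of $\langle
Px,x\rangle$ along the system. -/
theorem quadForm_neg_lmi {P : Matrix (Fin m) (Fin m) 𝕜} (hP : P.IsHermitian) (x : Fin m → 𝕜)
    (u : Fin n → 𝕜) :
    quadForm (-lmi A B Q S R P) (Sum.elim x u) =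
      supplyRate Q S R x u - 2 * RCLike.re (star x ⬝ᵥ P *ᵥ (A *ᵥ x + B *ᵥ u)) := by
  have e : fromBlocks (Aᴴ * P + (Aᴴ * P)ᴴ) (P * B) (Bᴴ * P) 0 =
      fromBlocks (Aᴴ * P + P * A) (Bᴴ * P)ᴴ (Bᴴ * P) 0 := by
    simp [conjTranspose_mul, hP.eq]
  have h1 : RCLike.re (star x ⬝ᵥ (Aᴴ * P) *ᵥ x) = RCLike.re (star x ⬝ᵥ P *ᵥ (A *ᵥ x)) := by
    rw [← mulVec_mulVec, dotProduct_mulVec, ← star_mulVec, re_dotProduct_mulVec_comm hP]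
  have h2 : RCLike.re (star u ⬝ᵥ (Bᴴ * P) *ᵥ x) = RCLike.re (star x ⬝ᵥ P *ᵥ (B *ᵥ u)) := by
    rw [← mulVec_mulVec, dotProduct_mulVec, ← star_mulVec, re_dotProduct_mulVec_comm hP]
  rw [lmi, e, neg_sub, quadForm_sub, ← supplyRate_eq_quadForm, ← supplyRate_eq_quadForm]
  congr 1
  rw [supplyRate, add_mulVec, dotProduct_add, map_add, h1, h2, zero_mulVec, dotProduct_zero,
    ← mulVec_mulVec, mulVec_add, dotProduct_add, map_add, map_zero]
  ring

theorem IsTrajectory.energy_eq_add_integral {x : ℝ → Fin m → 𝕜} {u : ℝ → Fin n → 𝕜}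
    (h : IsTrajectory A B x u) {P : Matrix (Fin m) (Fin m) 𝕜} (hP : P.IsHermitian) {T : ℝ}
    (hT : 0 ≤ T) :
    energy Q S R x u 0 T = quadForm P (x T) - quadForm P (x 0) +
      ∫ s in (0 : ℝ)..T, quadForm (-lmi A B Q S R P) (Sum.elim (x s) (u s)) := by
  rw [h.quadForm_sub_eq_integral hP hT]
  have i₁ := h.intervalIntegrable_supplyRate Q S R hT
  have i₂ := h.intervalIntegrable_quadForm (-lmi A B Q S R P) hT
  have e : ∀ s, 2 * RCLike.re (star (x s) ⬝ᵥ P *ᵥ (A *ᵥ x s + B *ᵥ u s)) =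
      supplyRate Q S R (x s) (u s) - quadForm (-lmi A B Q S R P) (Sum.elim (x s) (u s)) := fun s => by
    rw [quadForm_neg_lmi hP]
    ring
  simp only [e]
  rw [intervalIntegral.integral_sub i₁ i₂, energy]
  ring

/-- Append the given trajectory to any one that reaches `x 0` from the origin, then take the
infimum. -/
theorem IsRequiredSupplyMatrix.quadForm_le {P : Matrix (Fin m) (Fin m) 𝕜}
    (hP : IsRequiredSupplyMatrix A B Q S R P) {x : ℝ → Fin m → 𝕜} {u : ℝ → Fin n → 𝕜}
    (h : IsTrajectory A B x u) {t : ℝ} (ht : 0 ≤ t) :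
    quadForm P (x t) ≤ quadForm P (x 0) + energy Q S R x u 0 t := by
  rw [← sub_le_iff_le_add]
  refine (hP.2 (x 0)).2 fun e he => ?_
  rw [sub_le_iff_le_add]
  exact (hP.2 (x t)).1 (add_energy_mem_supplySet h he ht)

/-- Every initial state and initial input value belong to a trajectory with continuous input. -/
theorem exists_continuous_trajectory (A : Matrix (Fin m) (Fin m) 𝕜) (B : Matrix (Fin m) (Fin n) 𝕜)
    (x₀ : Fin m → 𝕜) (u₀ : Fin n → 𝕜) :
    ∃ (x : ℝ → Fin m → 𝕜) (u : ℝ → Fin n → 𝕜), IsTrajectory A B x u ∧ Continuous x ∧ Continuous u ∧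
      x 0 = x₀ ∧ u 0 = u₀ := by
  -- Adjoining $\dot u=0$ makes the system autonomous, solved by an exponential.
  let L₀ : (Fin m → 𝕜) × (Fin n → 𝕜) →ₗ[ℝ] (Fin m → 𝕜) × (Fin n → 𝕜) :=
    (((mulVecLin A).coprod (mulVecLin B)).prod 0).restrictScalars ℝ
  let L := L₀.toContinuousLinearMap
  let z : ℝ → (Fin m → 𝕜) × (Fin n → 𝕜) := fun t => NormedSpace.exp (t • L) (x₀, u₀)
  have z0 : z 0 = (x₀, u₀) := by
    simp only [z]
    rw [zero_smul ℝ L, NormedSpace.exp_zero]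
    rfl
  have hz : ∀ t, HasDerivAt z (L (z t)) t := fun t => by
    have := (hasDerivAt_exp_smul_const' (𝕂 := ℝ) L t).clm_apply (hasDerivAt_const t (x₀, u₀))
    simpa using this
  have hzc : Continuous z := continuous_iff_continuousAt.2 fun t => (hz t).continuousAt
  have hx : ∀ t, HasDerivAt (fun t => (z t).1) (A *ᵥ (z t).1 + B *ᵥ (z t).2) t := fun t =>
    (hz t).fst
  have hv : Continuous fun t => A *ᵥ (z t).1 + B *ᵥ (z t).2 := by fun_prop
  refine ⟨fun t => (z t).1, fun t => (z t).2, ⟨fun T => ?_, hzc.fst.continuousOn, fun t _ => ?_⟩,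
    hzc.fst, hzc.snd, congrArg Prod.fst z0, congrArg Prod.snd z0⟩
  · obtain ⟨C, hC⟩ := (isCompact_Icc (a := (0 : ℝ)) (b := T)).exists_bound_of_continuousOn
      hzc.snd.continuousOn
    exact MemLp.of_bound hzc.snd.aestronglyMeasurable C
      ((ae_restrict_iff' measurableSet_Icc).2 (ae_of_all _ hC))
  · rw [intervalIntegral.integral_eq_sub_of_hasDerivAt (fun s _ => hx s)
      (hv.intervalIntegrable 0 t)]
    abel

theorem nonneg_of_integral_nonneg {k : ℝ → ℝ} (hk : Continuous k)
    (h : ∀ t, 0 ≤ t → 0 ≤ ∫ s in (0 : ℝ)..t, k s) : 0 ≤ k 0 := by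
  by_contra! hneg
  have hd := intervalIntegral.integral_hasDerivAt_right (hk.intervalIntegrable 0 0)
    (hk.stronglyMeasurableAtFilter _ _) hk.continuousAt
  have hs := hd.hasDerivWithinAt (s := Set.Ioi 0)
  rw [hasDerivWithinAt_iff_tendsto_slope' (by simp)] at hs
  refine absurd (ge_of_tendsto hs ?_) (not_le.2 hneg)
  filter_upwards [self_mem_nhdsWithin] with t ht
  rw [slope_def_field, intervalIntegral.integral_same, sub_zero, sub_zero]
  exact div_nonneg (h t (le_of_lt ht)) (le_of_lt ht)

/-- By the dissipation inequality the form of $-\Lambda(P)$ has nonnegative integral over every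
$[0,t]$. Along a continuous pair starting at an arbitrary $(x,u)$, letting $t\to 0$ gives the
pointwise inequality. -/
theorem IsRequiredSupplyMatrix.solvesLMI {P : Matrix (Fin m) (Fin m) 𝕜}
    (hP : IsRequiredSupplyMatrix A B Q S R P) (hQ : Q.IsHermitian) (hR : R.IsHermitian) :
    SolvesLMI A B Q S R P := by
  refine ⟨hP.1, (posSemidef_iff_quadForm (isHermitian_lmi hQ hR hP.1).neg).2 fun z => ?_⟩
  obtain ⟨x, u, h, hx, hu, x0, u0⟩ := exists_continuous_trajectory A B (z ∘ Sum.inl) (z ∘ Sum.inr)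
  have hzc : Continuous fun s => Sum.elim (x s) (u s) := continuous_pi fun i => by
    cases i
    · exact (continuous_apply _).comp hx
    · exact (continuous_apply _).comp hu
  have := nonneg_of_integral_nonneg ((continuous_quadForm (-lmi A B Q S R P)).comp hzc) fun t ht => by
    have h1 := hP.quadForm_le h ht
    rw [h.energy_eq_add_integral hP.1 ht] at h1
    simp only [Function.comp_apply]
    linarith
  simpa [x0, u0] using this

theorem SolvesLMI.quadForm_le_of_mem_supplySet {P : Matrix (Fin m) (Fin m) 𝕜}
    (hP : SolvesLMI A B Q S R P) {x₀ : Fin m → 𝕜} {e : ℝ} (he : e ∈ supplySet A B Q S R x₀) :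
    quadForm P x₀ ≤ e := by
  obtain ⟨x, u, T, hT, h, h0, rfl, rfl⟩ := he
  rw [h.energy_eq_add_integral hP.1 hT, h0, quadForm_zero, sub_zero]
  have := intervalIntegral.integral_nonneg (μ := volume) hT fun s _ =>
    (posSemidef_iff_quadForm hP.2.1).1 hP.2 (Sum.elim (x s) (u s))
  linarith

theorem IsRequiredSupplyMatrix.posSemidef_sub {P P' : Matrix (Fin m) (Fin m) 𝕜}
    (hP : IsRequiredSupplyMatrix A B Q S R P) (hP' : SolvesLMI A B Q S R P') :
    (P - P').PosSemidef := by
  refine (posSemidef_iff_quadForm (hP.1.sub hP'.1)).2 fun x₀ => ?_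
  rw [quadForm_sub, sub_nonneg]
  exact (hP.2 x₀).2 fun e he => hP'.quadForm_le_of_mem_supplySet he

theorem IsRequiredSupplyMatrix.posSemidef {P : Matrix (Fin m) (Fin m) 𝕜}
    (hP : IsRequiredSupplyMatrix A B Q S R P) (hmin : MinimallyStable A B Q S R) :
    P.PosSemidef := by
  refine (posSemidef_iff_quadForm hP.1).2 fun x₀ => ?_
  obtain ⟨x, u, h, rfl, hE, hlim⟩ := hmin x₀
  have h1 : Tendsto (fun t => quadForm P (x t)) atTop (𝓝 0) := by
    have := ((continuous_quadForm P).tendsto 0).comp hlim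
    rwa [quadForm_zero] at this
  refine le_of_tendsto h1 ?_
  filter_upwards [eventually_ge_atTop 0] with t ht
  linarith [hP.quadForm_le h ht, hE t ht]

end Dissipation

end LTI

namespace LTI

/-! ### Zeros of the system pencil produced by decaying trajectories. -/

section StableZeros

variable {m n : ℕ} {A : Matrix (Fin m) (Fin m) ℂ} {B : Matrix (Fin m) (Fin n) ℂ}

theorem IsTrajectory.ae_hasDerivAt {x : ℝ → Fin m → ℂ} {u : ℝ → Fin n → ℂ}
    (h : IsTrajectory A B x u) :
    ∀ᵐ t, 0 < t → HasDerivAt x (A *ᵥ x t + B *ᵥ u t) t := by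
  have hT : ∀ N : ℕ, ∀ᵐ t, t ∈ Set.Ioo (0 : ℝ) N → HasDerivAt x (A *ᵥ x t + B *ᵥ u t) t := fun N => by
    have hN : (0 : ℝ) ≤ N := N.cast_nonneg
    filter_upwards [(h.intervalIntegrable_velocity hN).ae_hasDerivAt_integral] with t ht htN
    have h1 := (ht (by rw [Set.uIcc_of_le hN]; exact Set.Ioo_subset_Icc_self htN) 0
      Set.left_mem_uIcc).const_add (x 0)
    refine h1.congr_of_eventuallyEq ?_
    filter_upwards [lt_mem_nhds htN.1] with s hs
    exact h.state_eq s hs.le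
  filter_upwards [ae_all_iff.2 hT] with t ht h0
  obtain ⟨N, hN⟩ := exists_nat_gt t
  exact ht N ⟨h0, hN⟩

theorem mem_of_hasDerivAt_of_forall_mem {W : Submodule ℂ (Fin m → ℂ)} {x : ℝ → Fin m → ℂ}
    {v : Fin m → ℂ} {t : ℝ} (hx : HasDerivAt x v t) (hW : ∀ᶠ s in 𝓝 t, x s ∈ W) : v ∈ W := by
  refine W.closed_of_finiteDimensional.mem_of_tendsto (hasDerivAt_iff_tendsto_slope.1 hx) ?_
  have h1 : x t ∈ W := hW.self_of_nhds
  filter_upwards [hW.filter_mono nhdsWithin_le_nhds] with s hs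
  rw [slope_def_module, RCLike.real_smul_eq_coe_smul (K := ℂ)]
  exact W.smul_mem _ (W.sub_mem hs h1)

/-- A set of full measure accumulates at every $t\ge 0$ from the right, and `W` is closed. -/
theorem forall_mem_of_ae_mem {W : Submodule ℂ (Fin m → ℂ)} {x : ℝ → Fin m → ℂ}
    (hx : ContinuousOn x (Set.Ici 0)) (hW : ∀ᵐ t : ℝ, 0 < t → x t ∈ W) {t : ℝ} (ht : 0 ≤ t) :
    x t ∈ W := by
  have hfreq : ∃ᶠ s in 𝓝[>] t, x s ∈ W := by
    intro hev
    obtain ⟨b, hb, hsub⟩ := mem_nhdsGT_iff_exists_Ioo_subset.1 hev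
    have h0 : volume (Set.Ioo t b) = 0 := by
      refine measure_mono_null (fun s hs => ?_) hW
      have h1 : ¬ x s ∈ W := hsub hs
      have h2 : 0 < s := ht.trans_lt hs.1
      simpa [h2] using h1
    rw [Real.volume_Ioo, ENNReal.ofReal_eq_zero] at h0
    have : t < b := hb
    linarith
  have hlim : Tendsto x (𝓝[>] t) (𝓝 (x t)) :=
    (hx t ht).mono_left (nhdsWithin_mono _ fun s hs => ht.trans (le_of_lt hs))
  exact W.closed_of_finiteDimensional.mem_of_frequently_of_tendsto hfreq hlim

/-- If a stable trajectory annihilates the output `K (x, u)`, and the system matrix is injective at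
some point, then the system matrix has a zero in the open left half plane. -/
theorem exists_stable_zero {x : ℝ → Fin m → ℂ} {u : ℝ → Fin n → ℂ} (h : IsTrajectory A B x u)
    (hx0 : x 0 ≠ 0) (hlim : Tendsto x atTop (𝓝 0))
    {K : Matrix (Fin m ⊕ Fin n) (Fin m ⊕ Fin n) ℂ}
    (hK : ∀ᵐ t : ℝ, 0 < t → K *ᵥ Sum.elim (x t) (u t) = 0) {s₀ : ℂ}
    (hinj : ∀ v w, s₀ • v = A *ᵥ v + B *ᵥ w → K *ᵥ Sum.elim v w = 0 → v = 0 ∧ w = 0) :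
    ∃ (l : ℂ) (v : Fin m → ℂ) (w : Fin n → ℂ), l.re < 0 ∧ v ≠ 0 ∧ l • v = A *ᵥ v + B *ᵥ w ∧
      K *ᵥ Sum.elim v w = 0 := by
  let W : Submodule ℂ (Fin m → ℂ) := Submodule.span ℂ (x '' Set.Ici 0)
  have hxW : ∀ t, 0 ≤ t → x t ∈ W := fun t ht => Submodule.subset_span ⟨t, ht, rfl⟩
  let a : (Fin m → ℂ) × (Fin n → ℂ) →ₗ[ℂ] (Fin m → ℂ) := (mulVecLin A).coprod (mulVecLin B)
  let k : (Fin m → ℂ) × (Fin n → ℂ) →ₗ[ℂ] (Fin m ⊕ Fin n → ℂ) :=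
    (mulVecLin K).comp (LinearEquiv.sumArrowLequivProdArrow (Fin m) (Fin n) ℂ ℂ).symm.toLinearMap
  have ha : ∀ v w, a (v, w) = A *ᵥ v + B *ᵥ w := fun v w => rfl
  have hk : ∀ v w, k (v, w) = K *ᵥ Sum.elim v w := fun v w => rfl
  -- Pairs whose state and velocity lie in the span `W` of the trajectory and whose output vanishes.
  -- The projection `π` maps `U` onto `W`, and `α - s₀ • π` is injective by `hinj`; so the
  -- dimensions agree, `π` is bijective, and $\dot x=Gx$ on `W`.
  let U : Submodule ℂ ((Fin m → ℂ) × (Fin n → ℂ)) :=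
    W.comap (LinearMap.fst ℂ _ _) ⊓ W.comap a ⊓ LinearMap.ker k
  have hxU : ∀ᵐ t : ℝ, 0 < t → (x t, u t) ∈ U := by
    filter_upwards [h.ae_hasDerivAt, hK] with t hd hKt ht
    refine ⟨⟨hxW t ht.le, ?_⟩, hKt ht⟩
    refine mem_of_hasDerivAt_of_forall_mem (W := W) (hd ht) ?_
    filter_upwards [lt_mem_nhds ht] with s hs
    exact hxW s hs.le
  let π : U →ₗ[ℂ] W := ((LinearMap.fst ℂ _ _).comp U.subtype).codRestrict W fun z => z.2.1.1
  let α : U →ₗ[ℂ] W := (a.comp U.subtype).codRestrict W fun z => z.2.1.2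
  have hπsurj : Function.Surjective π := by
    have hle : W ≤ U.map (LinearMap.fst ℂ _ _) := by
      refine Submodule.span_le.2 ?_
      rintro _ ⟨t, ht, rfl⟩
      refine forall_mem_of_ae_mem h.continuousOn_state ?_ ht
      filter_upwards [hxU] with s hs h0
      exact ⟨_, hs h0, rfl⟩
    rintro ⟨v, hv⟩
    obtain ⟨z, hz, rfl⟩ := hle hv
    exact ⟨⟨z, hz⟩, rfl⟩
  have hδinj : Function.Injective (α - s₀ • π) := by
    rw [← LinearMap.ker_eq_bot, LinearMap.ker_eq_bot']
    rintro ⟨⟨v, w⟩, hz⟩ hzero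
    have h1 : A *ᵥ v + B *ᵥ w - s₀ • v = 0 := congrArg Subtype.val hzero
    obtain ⟨rfl, rfl⟩ := hinj v w (sub_eq_zero.1 h1).symm hz.2
    rfl
  have hdim : Module.finrank ℂ U = Module.finrank ℂ W :=
    le_antisymm (LinearMap.finrank_le_finrank_of_injective hδinj)
      (LinearMap.finrank_le_finrank_of_surjective hπsurj)
  have hπinj : Function.Injective π :=
    (LinearMap.injective_iff_surjective_of_finrank_eq_finrank hdim).2 hπsurj
  let e : U ≃ₗ[ℂ] W := LinearEquiv.ofBijective π ⟨hπinj, hπsurj⟩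
  let G : W →ₗ[ℂ] W := α.comp e.symm.toLinearMap
  have hG : ∀ z : U, G (π z) = α z := fun z => by
    change α (e.symm (e z)) = α z
    rw [e.symm_apply_apply]
  have : Nontrivial W := ⟨⟨x 0, hxW 0 le_rfl⟩, 0, fun h0 => hx0 (congrArg Subtype.val h0)⟩
  -- An eigenfunctional $f$ reduces the dynamics to $f(x(t))=e^{lt}f(x(0))$. Here $f(x(0))\ne 0$,
  -- since otherwise $f$ would vanish on the span `W`; decay then forces $\operatorname{Re} l<0$.
  obtain ⟨l, hl⟩ := Module.End.exists_eigenvalue (K := ℂ) (V := Module.Dual ℂ W) G.dualMap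
  obtain ⟨f, hf⟩ := hl.exists_hasEigenvector
  have hfG : ∀ z, f (G z) = l * f z := fun z => LinearMap.congr_fun hf.apply_eq_smul z
  have hGl : ¬ Function.Injective (G - l • LinearMap.id : W →ₗ[ℂ] W) := fun hi => by
    have hs := LinearMap.injective_iff_surjective.1 hi
    refine hf.2 (LinearMap.ext fun z => ?_)
    obtain ⟨y, rfl⟩ := hs z
    simp [hfG]
  obtain ⟨f', hf'⟩ := LinearMap.exists_extend f
  have hff' : ∀ z : W, f' z = f z := fun z => LinearMap.congr_fun hf' z
  let F : (Fin m → ℂ) →L[ℝ] ℂ := (f'.restrictScalars ℝ).toContinuousLinearMap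
  have hF : ∀ z, F z = f' z := fun z => rfl
  have hyc : ContinuousOn (fun t => F (x t)) (Set.Ici 0) :=
    F.continuous.comp_continuousOn h.continuousOn_state
  have hy : ∀ t, 0 ≤ t → F (x t) = F (x 0) + ∫ s in (0 : ℝ)..t, l * F (x s) := fun t ht => by
    conv_lhs => rw [h.state_eq t ht]
    rw [map_add, ← F.intervalIntegral_comp_comm (h.intervalIntegrable_velocity ht)]
    congr 1
    refine intervalIntegral.integral_congr_ae ?_
    filter_upwards [hxU] with s hs hst
    rw [Set.uIoc_of_le ht] at hst
    have h1 := hfG (π ⟨_, hs hst.1⟩)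
    rw [hG, ← hff', ← hff'] at h1
    exact h1
  have hexp : ∀ T : ℝ, 0 ≤ T → Complex.exp (-l * T) * F (x T) = F (x 0) := fun T hT => by
    have hder : ∀ s : ℝ, HasDerivAt (fun s : ℝ => Complex.exp (-l * s)) (-l * Complex.exp (-l * s)) s :=
      fun s => by
        have h1 : HasDerivAt (fun s : ℝ => -l * (s : ℂ)) (-l) s := by
          simpa using (Complex.ofRealCLM.hasDerivAt (x := s)).const_mul (-l)
        exact h1.cexp.congr_deriv (mul_comm _ _)
    have hdc : Continuous fun s : ℝ => -l * Complex.exp (-l * s) := by fun_prop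
    have hyi : IntervalIntegrable (fun s => l * F (x s)) volume 0 T := by
      refine ContinuousOn.intervalIntegrable ?_
      rw [Set.uIcc_of_le hT]
      exact continuousOn_const.mul (hyc.mono Set.Icc_subset_Ici_self)
    have key := integral_mul_add_mul_eq_sub (F := fun s : ℝ => Complex.exp (-l * s))
      (G := fun s => F (x s)) hT (hdc.intervalIntegrable 0 T) hyi
      (fun t _ => by
        rw [intervalIntegral.integral_eq_sub_of_hasDerivAt (fun s _ => hder s)
          (hdc.intervalIntegrable 0 t)]
        ring)
      (fun t ht => hy t ht.1)
    have e0 : ∀ s : ℝ, -l * Complex.exp (-l * s) * F (x s) + Complex.exp (-l * s) * (l * F (x s)) = 0 :=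
      fun s => by ring
    simp only [e0, intervalIntegral.integral_zero] at key
    have := (sub_eq_zero.1 key.symm)
    simpa using this
  have hF0 : F (x 0) ≠ 0 := fun h0 => by
    refine hf.2 (LinearMap.ext fun z => ?_)
    have hle : W ≤ LinearMap.ker f' := by
      refine Submodule.span_le.2 ?_
      rintro _ ⟨t, ht, rfl⟩
      have := hexp t ht
      rw [h0] at this
      exact (mul_eq_zero.1 this).resolve_left (Complex.exp_ne_zero _)
    rw [← hff']
    exact hle z.2
  have hre : l.re < 0 := by
    by_contra! hge
    have hlimF : Tendsto (fun t => ‖F (x t)‖) atTop (𝓝 0) := by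
      have := ((F.continuous.norm).tendsto 0).comp hlim
      simpa [Function.comp_def] using this
    have hbound : ‖F (x 0)‖ ≤ 0 := by
      refine ge_of_tendsto hlimF ?_
      filter_upwards [eventually_ge_atTop 0] with t ht
      rw [← hexp t ht, norm_mul, Complex.norm_exp]
      refine mul_le_of_le_one_left (norm_nonneg _) (Real.exp_le_one_iff.2 ?_)
      simpa using mul_nonneg hge ht
    exact hF0 (norm_le_zero_iff.1 hbound)
  rw [← LinearMap.ker_eq_bot, LinearMap.ker_eq_bot'] at hGl
  push Not at hGl
  obtain ⟨v, hv, hv0⟩ := hGl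
  obtain ⟨⟨⟨v', w⟩, hz⟩, rfl⟩ := hπsurj v
  refine ⟨l, v', w, hre, fun h0 => hv0 (Subtype.ext h0), ?_, hz.2⟩
  have h1 : G (π ⟨(v', w), hz⟩) = l • π ⟨(v', w), hz⟩ := sub_eq_zero.1 hv
  rw [hG] at h1
  exact (congrArg Subtype.val h1).symm

/-- At a zero of the system matrix there is a left null vector with nonzero first component. -/
theorem exists_left_null {K : Matrix (Fin m ⊕ Fin n) (Fin m ⊕ Fin n) ℂ} {s₀ : ℂ}
    (hinj : ∀ v w, s₀ • v = A *ᵥ v + B *ᵥ w → K *ᵥ Sum.elim v w = 0 → v = 0 ∧ w = 0)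
    {l : ℂ} {v₀ : Fin m → ℂ} {w₀ : Fin n → ℂ} (hv₀ : v₀ ≠ 0) (hl : l • v₀ = A *ᵥ v₀ + B *ᵥ w₀)
    (hK : K *ᵥ Sum.elim v₀ w₀ = 0) :
    ∃ (p : Fin m → ℂ) (q : Fin m ⊕ Fin n → ℂ), p ≠ 0 ∧ ∀ x u,
      p ⬝ᵥ (A *ᵥ x + B *ᵥ u) = l * (p ⬝ᵥ x) + star q ⬝ᵥ K *ᵥ Sum.elim x u := by
  let E := (Fin m → ℂ) × (Fin n → ℂ)
  let a : E →ₗ[ℂ] (Fin m → ℂ) := (mulVecLin A).coprod (mulVecLin B)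
  let k₀ : (Fin m ⊕ Fin n → ℂ) →ₗ[ℂ] (Fin m ⊕ Fin n → ℂ) := mulVecLin K
  let r := (LinearEquiv.sumArrowLequivProdArrow (Fin m) (Fin n) ℂ ℂ).symm
  -- With the range of `K` as codomain, an annihilating functional with $p=0$ would vanish
  -- identically; this is what gives $p\ne 0$.
  let k : E →ₗ[ℂ] LinearMap.range k₀ := k₀.rangeRestrict.comp r.toLinearMap
  let Φ : ℂ → E →ₗ[ℂ] (Fin m → ℂ) × LinearMap.range k₀ := fun s =>
    (s • LinearMap.fst ℂ _ _ - a).prod k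
  have hΦ₀ : Function.Injective (Φ s₀) := by
    rw [← LinearMap.ker_eq_bot, LinearMap.ker_eq_bot']
    rintro ⟨v, w⟩ hz
    have h1 : s₀ • v - (A *ᵥ v + B *ᵥ w) = 0 := congrArg Prod.fst hz
    have h2 : K *ᵥ Sum.elim v w = 0 := congrArg (fun z => (Prod.snd z).val) hz
    obtain ⟨rfl, rfl⟩ := hinj v w (sub_eq_zero.1 h1) h2
    rfl
  have hΦl : ¬ Function.Injective (Φ l) := fun hi => by
    have h1 : Φ l (v₀, w₀) = 0 := Prod.ext (sub_eq_zero.2 hl) (Subtype.ext hK)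
    exact hv₀ (congrArg Prod.fst (hi (h1.trans (map_zero _).symm)))
  have hdim := LinearMap.finrank_le_finrank_of_injective hΦ₀
  -- Injectivity at `s₀` bounds the dimension of the domain by that of the codomain, so surjectivity
  -- at `l` would force equality and injectivity there.
  have hlt : LinearMap.range (Φ l) < ⊤ := by
    rw [lt_top_iff_ne_top]
    intro htop
    have hsurj := LinearMap.range_eq_top.1 htop
    have hdim' := LinearMap.finrank_le_finrank_of_surjective hsurj
    exact hΦl ((LinearMap.injective_iff_surjective_of_finrank_eq_finrank (hdim.antisymm hdim')).2 hsurj)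
  obtain ⟨f, hf0, hf⟩ := Submodule.exists_le_ker_of_lt_top _ hlt
  obtain ⟨g, hg⟩ := LinearMap.exists_extend (f.comp (LinearMap.inr ℂ _ _))
  have hgz : ∀ z : LinearMap.range k₀, g z = f (0, z) := fun z => LinearMap.congr_fun hg z
  have hdual : ∀ {ι : Type} [Fintype ι] [DecidableEq ι] (φ : (ι → ℂ) →ₗ[ℂ] ℂ) (z : ι → ℂ),
      φ z = (fun i => φ (Pi.single i 1)) ⬝ᵥ z := fun φ z => by
    conv_lhs => rw [LinearMap.pi_apply_eq_sum_univ φ z]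
    simp only [dotProduct, smul_eq_mul]
    refine Finset.sum_congr rfl fun i _ => ?_
    rw [mul_comm]
    congr 2
    ext j
    simp [Pi.single_apply, eq_comm]
  have hp := hdual (f.comp (LinearMap.inl ℂ _ _))
  have hq := hdual g
  refine ⟨fun i => f.comp (LinearMap.inl ℂ _ _) (Pi.single i 1),
    star fun i => g (Pi.single i 1), fun hp0 => ?_, fun x u => ?_⟩
  · refine hf0 (LinearMap.ext fun ⟨y, z⟩ => ?_)
    have hzero : ∀ y, f (y, 0) = 0 := fun y => by
      have := hp y
      rw [hp0, zero_dotProduct] at this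
      exact this
    obtain ⟨z', rfl⟩ := k₀.surjective_rangeRestrict z
    have h1 := hf ⟨r.symm z', rfl⟩
    have h2 : f (Φ l (r.symm z')) = f ((Φ l (r.symm z')).1, 0) + f (0, (Φ l (r.symm z')).2) := by
      rw [← map_add, Prod.mk_add_mk, add_zero, zero_add]
    have h3 : (Φ l (r.symm z')).2 = k₀.rangeRestrict z' := by
      change k₀.rangeRestrict (r (r.symm z')) = _
      rw [r.apply_symm_apply]
    have h4 : f (Φ l (r.symm z')) = 0 := h1
    rw [hzero, zero_add, h3, h4] at h2
    have h5 : f (y, k₀.rangeRestrict z') = f (y, 0) + f (0, k₀.rangeRestrict z') := by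
      rw [← map_add, Prod.mk_add_mk, add_zero, zero_add]
    rw [h5, hzero, ← h2, add_zero]
    rfl
  · have h1 : f (Φ l (x, u)) = 0 := hf ⟨(x, u), rfl⟩
    have h2 : Φ l (x, u) = (l • x - (A *ᵥ x + B *ᵥ u), 0) + (0, k (x, u)) := by
      rw [Prod.mk_add_mk, add_zero, zero_add]
      rfl
    have h3 : f (l • x - (A *ᵥ x + B *ᵥ u), 0) = f.comp (LinearMap.inl ℂ _ _) (l • x - (A *ᵥ x + B *ᵥ u)) :=
      rfl
    rw [h2, map_add, ← hgz, h3, hp, hq, dotProduct_sub, dotProduct_smul, smul_eq_mul] at h1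
    rw [star_star]
    have h4 : ((k (x, u) : LinearMap.range k₀) : Fin m ⊕ Fin n → ℂ) = K *ᵥ Sum.elim x u := rfl
    rw [h4] at h1
    linear_combination -h1

end StableZeros

end LTI

/-! ### Positive definiteness of the required supply. -/

namespace LTI

variable {𝕜 : Type*} [RCLike 𝕜] {m n : ℕ}
  {A : Matrix (Fin m) (Fin m) 𝕜} {B : Matrix (Fin m) (Fin n) 𝕜}
  {Q : Matrix (Fin m) (Fin m) 𝕜} {S : Matrix (Fin n) (Fin m) 𝕜} {R : Matrix (Fin n) (Fin n) 𝕜}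

theorem toComplex_mul {ι κ l : Type*} [Fintype κ] (M : Matrix ι κ 𝕜) (N : Matrix κ l 𝕜) :
    toComplex (M * N) = toComplex M * toComplex N :=
  Matrix.map_mul (f := complexify 𝕜)

theorem toComplex_lmi (P : Matrix (Fin m) (Fin m) 𝕜) :
    toComplex (lmi A B Q S R P) = lmi (toComplex A) (toComplex B) (toComplex Q) (toComplex S)
      (toComplex R) (toComplex P) := by
  have hsub : ∀ M N : Matrix (Fin m ⊕ Fin n) (Fin m ⊕ Fin n) 𝕜,
      toComplex (M - N) = toComplex M - toComplex N := fun M N => by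
    ext i j
    exact map_sub (complexify 𝕜) _ _
  have hadd : ∀ M N : Matrix (Fin m) (Fin m) 𝕜,
      toComplex (M + N) = toComplex M + toComplex N := fun M N => by
    ext i j
    exact map_add (complexify 𝕜) _ _
  have hblocks : ∀ (M₁ : Matrix (Fin m) (Fin m) 𝕜) (M₂ : Matrix (Fin m) (Fin n) 𝕜)
      (M₃ : Matrix (Fin n) (Fin m) 𝕜) (M₄ : Matrix (Fin n) (Fin n) 𝕜),
      toComplex (fromBlocks M₁ M₂ M₃ M₄) =
        fromBlocks (toComplex M₁) (toComplex M₂) (toComplex M₃) (toComplex M₄) := fun _ _ _ _ =>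
    fromBlocks_map _ _ _ _ _
  have hzero : toComplex (0 : Matrix (Fin n) (Fin n) 𝕜) = 0 := by
    ext i j
    exact map_zero (complexify 𝕜)
  rw [lmi, lmi, hsub, hblocks, hblocks, hadd, hzero]
  simp only [toComplex_mul, toComplex_conjTranspose]

theorem toComplex_neg {ι κ : Type*} (M : Matrix ι κ 𝕜) : toComplex (-M) = -toComplex M := by
  ext i j
  exact map_neg (complexify 𝕜) _

open scoped MatrixOrder in
-- When $\mathbb K=\mathbb R$, complex vectors need not come from real ones, so a factorization
-- $M=N^*N$ is transported instead of the inequality.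
theorem posSemidef_toComplex {ι : Type*} [Fintype ι] [DecidableEq ι] {M : Matrix ι ι 𝕜}
    (hM : M.PosSemidef) : (toComplex M).PosSemidef := by
  obtain ⟨N, rfl⟩ := CStarAlgebra.nonneg_iff_eq_star_mul_self.1 hM.nonneg
  rw [star_eq_conjTranspose, toComplex_mul, toComplex_conjTranspose]
  exact posSemidef_conjTranspose_mul_self _

theorem isHermitian_toComplex {ι : Type*} {M : Matrix ι ι 𝕜} (hM : M.IsHermitian) :
    (toComplex M).IsHermitian := by
  rw [IsHermitian, ← toComplex_conjTranspose, hM.eq]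

/-- If `det Π(-s, s) ≠ 0`, then the system matrix at `s` with output `-Λ(P) (x, u)` is injective. -/
theorem eq_zero_of_popov_det_ne_zero {s : ℂ}
    (hs : (s • (1 : Matrix (Fin m) (Fin m) ℂ) - toComplex A).det ≠ 0)
    (hs' : (star (-s) • (1 : Matrix (Fin m) (Fin m) ℂ) - toComplex A).det ≠ 0)
    (hdet : (popov A B Q S R (-s) s).det ≠ 0) {P : Matrix (Fin m) (Fin m) 𝕜} (hP : P.IsHermitian)
    {v : Fin m → ℂ} {w : Fin n → ℂ} (hvw : s • v = toComplex A *ᵥ v + toComplex B *ᵥ w)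
    (hK : toComplex (-lmi A B Q S R P) *ᵥ Sum.elim v w = 0) : v = 0 ∧ w = 0 := by
  set A' := toComplex A
  set B' := toComplex B
  set P' := toComplex P
  have hP' : P'.IsHermitian := isHermitian_toComplex hP
  have hM : toComplex (fromBlocks Q Sᴴ S R) *ᵥ Sum.elim v w =
      Sum.elim (A'ᴴ *ᵥ (P' *ᵥ v) + s • (P' *ᵥ v)) (B'ᴴ *ᵥ (P' *ᵥ v)) := by
    have h1 : toComplex (fromBlocks Q Sᴴ S R) =
        fromBlocks (A'ᴴ * P' + (A'ᴴ * P')ᴴ) (P' * B') (B'ᴴ * P') 0 -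
          lmi A' B' (toComplex Q) (toComplex S) (toComplex R) P' := by
      rw [lmi, sub_sub_cancel, ← toComplex_conjTranspose]
      exact fromBlocks_map _ _ _ _ _
    rw [toComplex_neg, toComplex_lmi, neg_mulVec, neg_eq_zero] at hK
    rw [h1, sub_mulVec, hK, sub_zero, fromBlocks_mulVec]
    simp only [Sum.elim_comp_inl, Sum.elim_comp_inr, add_mulVec, conjTranspose_mul,
      conjTranspose_conjTranspose, hP'.eq, zero_mulVec, add_zero, ← mulVec_mulVec]
    congr 1
    rw [add_assoc, ← mulVec_add, ← hvw, mulVec_smul]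
  have hw : popov A B Q S R (-s) s *ᵥ w = 0 := by
    rw [popov, ← mulVec_mulVec, resolventColumn_mulVec hs hvw, ← mulVec_mulVec, hM]
    -- Pairing with the left column at $\bar g$ leaves $(Ay+B\bar g+\bar s y)^*Pv$, which vanishes
    -- because $-\bar s y=Ay+B\bar g$.
    refine dotProduct_eq_zero_iff.1 fun g => ?_
    set y : Fin m → ℂ := (star (-s) • (1 : Matrix (Fin m) (Fin m) ℂ) - A')⁻¹ *ᵥ (B' *ᵥ star g)
    have hy : star (-s) • y = A' *ᵥ y + B' *ᵥ star g := by
      have h1 : (star (-s) • (1 : Matrix (Fin m) (Fin m) ℂ) - A') *ᵥ y = B' *ᵥ star g := by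
        rw [mulVec_mulVec, mul_nonsing_inv _ (isUnit_iff_ne_zero.2 hs'), one_mulVec]
      rw [sub_mulVec, smul_mulVec, one_mulVec] at h1
      rw [← h1, add_sub_cancel]
    have hcol := resolventColumn_mulVec hs' hy
    have h2 : star (Sum.elim y (star g)) = Sum.elim (star y) g := by
      ext i
      cases i <;> simp
    rw [dotProduct_comm, ← star_star g, dotProduct_mulVec, ← star_mulVec, hcol, h2,
      sumElim_dotProduct_sumElim, dotProduct_add,
      dotProduct_mulVec (star y), dotProduct_mulVec g, ← star_mulVec]
    have h3 : star (B' *ᵥ star g) = g ᵥ* B'ᴴ := by rw [star_mulVec, star_star]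
    rw [← h3, dotProduct_smul, ← smul_dotProduct, ← add_dotProduct, ← add_dotProduct]
    have h4 : s • star y = star (-(star (-s) • y)) := by simp
    rw [h4, hy, ← star_add, ← star_add]
    simp
  have hw0 : w = 0 := eq_zero_of_mulVec_eq_zero hdet hw
  subst hw0
  refine ⟨eq_zero_of_mulVec_eq_zero hs ?_, rfl⟩
  rw [sub_mulVec, smul_mulVec, one_mulVec, hvw, mulVec_zero, add_zero, sub_self]

/-- A stable left null vector of the system matrix improves the lower bound on the supply. -/
theorem exists_improved_bound {P : Matrix (Fin m) (Fin m) 𝕜} (hP : SolvesLMI A B Q S R P) {l : ℂ}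
    (hl : l.re < 0) {p : Fin m → ℂ} {q : Fin m ⊕ Fin n → ℂ}
    (hpq : ∀ x u, p ⬝ᵥ (toComplex A *ᵥ x + toComplex B *ᵥ u) =
      l * (p ⬝ᵥ x) + star q ⬝ᵥ toComplex (-lmi A B Q S R P) *ᵥ Sum.elim x u) :
    ∃ ε : ℝ, 0 < ε ∧ ∀ x₀, ∀ e ∈ supplySet A B Q S R x₀,
      quadForm P x₀ + ε * ‖p ⬝ᵥ (complexify 𝕜 ∘ x₀)‖ ^ 2 ≤ e := by
  set K := toComplex (-lmi A B Q S R P) with hKdef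
  have hK : K.PosSemidef := posSemidef_toComplex hP.2
  have hKq : ∀ z, 0 ≤ quadForm K z := (posSemidef_iff_quadForm hK.1).1 hK
  set κ := quadForm K q with hκ
  have hκ0 : 0 ≤ κ := hKq q
  -- Only $0<\varepsilon$ and $\varepsilon\kappa\le-2\operatorname{Re}l$ matter; the $+1$ covers
  -- $\kappa=0$.
  set ε := -2 * l.re / (κ + 1) with hε
  have hε0 : 0 < ε := div_pos (by linarith) (by linarith)
  have hεκ : ε * κ ≤ -2 * l.re := by
    rw [hε, div_mul_eq_mul_div, div_le_iff₀ (by linarith)]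
    nlinarith
  -- `X` may be non-real even over $\mathbb R$, so the improvement is stated for energies and not as
  -- a solution $P+\varepsilon X$ over $\mathbb K$.
  set X : Matrix (Fin m) (Fin m) ℂ := vecMulVec (star p) p with hX
  have hXh : X.IsHermitian := by
    rw [IsHermitian, hX, conjTranspose_vecMulVec, star_star]
  have hXm : ∀ y z, star y ⬝ᵥ X *ᵥ z = star (p ⬝ᵥ y) * (p ⬝ᵥ z) := fun y z => by
    rw [hX, vecMulVec_mulVec, dotProduct_smul, star_dotProduct_star]
    simp
  have hXq : ∀ z, quadForm X z = ‖p ⬝ᵥ z‖ ^ 2 := fun z => by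
    rw [quadForm, hXm, RCLike.star_def, RCLike.conj_mul, ← RCLike.ofReal_pow, RCLike.ofReal_re]
  have hpt : ∀ x u, ε * (2 * RCLike.re (star x ⬝ᵥ X *ᵥ (toComplex A *ᵥ x + toComplex B *ᵥ u))) ≤
      quadForm K (Sum.elim x u) := fun x u => by
    set z := Sum.elim x u
    set c := p ⬝ᵥ x
    -- Nonnegativity at $z-\varepsilon cq$ bounds the cross term by
    -- $z^*Kz+\varepsilon^2\kappa|c|^2$; the decay term $2\varepsilon\operatorname{Re}(l)|c|^2$
    -- absorbs the excess.
    have h1 := hKq ((-ε) • (c • q) + z)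
    rw [quadForm_smul_add, quadForm_smul, re_dotProduct_mulVec_comm hK.1 z, star_smul,
      smul_dotProduct, smul_eq_mul] at h1
    have h3 : RCLike.re (star c * (l * c)) = l.re * ‖c‖ ^ 2 := by
      rw [mul_left_comm, RCLike.star_def, RCLike.conj_mul, ← RCLike.ofReal_pow, RCLike.re_mul_ofReal,
        RCLike.re_to_complex]
    rw [hXm, hpq, mul_add, map_add, h3]
    have h2 : ε * ‖c‖ ^ 2 * (ε * κ) ≤ ε * ‖c‖ ^ 2 * (-2 * l.re) :=
      mul_le_mul_of_nonneg_left hεκ (by positivity)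
    linarith
  refine ⟨ε, hε0, fun x₀ e he => ?_⟩
  obtain ⟨x, u, T, hT, h, h0, rfl, rfl⟩ := he
  have hc := h.complexify
  have h1 := hc.quadForm_sub_eq_integral hXh hT
  have hz0 : complexify 𝕜 ∘ x 0 = 0 := by
    ext i
    simp [h0]
  have hi := hc.intervalIntegrable_quadForm K hT
  have h2 : ε * quadForm X (complexify 𝕜 ∘ x T) ≤
      ∫ s in (0 : ℝ)..T, quadForm K (Sum.elim (complexify 𝕜 ∘ x s) (complexify 𝕜 ∘ u s)) := by
    rw [hz0, quadForm_zero, sub_zero] at h1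
    rw [h1, ← intervalIntegral.integral_const_mul]
    refine intervalIntegral.integral_mono_on hT ?_ hi fun s _ => hpt _ _
    -- Zero supply exhibits the derivative as a quadratic form in $(y,v)$, which gives its
    -- integrability.
    have hid : ∀ y v, 2 * RCLike.re (star y ⬝ᵥ X *ᵥ (toComplex A *ᵥ y + toComplex B *ᵥ v)) =
        -quadForm (-lmi (toComplex A) (toComplex B) 0 0 0 X) (Sum.elim y v) := fun y v => by
      rw [quadForm_neg_lmi hXh]
      simp [supplyRate]
    simp only [hid]
    exact ((hc.intervalIntegrable_quadForm _ hT).neg).const_mul _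
  rw [h.energy_eq_add_integral hP.1 hT, h0, quadForm_zero, sub_zero, ← hXq]
  simp only [← Sum.comp_elim, hKdef, quadForm_toComplex] at h2
  linarith

/-- The required supply is positive definite. -/
theorem IsRequiredSupplyMatrix.posDef {P : Matrix (Fin m) (Fin m) 𝕜}
    (hP : IsRequiredSupplyMatrix A B Q S R P) (hQ : Q.IsHermitian) (hR : R.IsHermitian)
    (hmin : MinimallyStable A B Q S R) (hdet : PopovDetNotIdenticallyZero A B Q S R) :
    P.PosDef := by
  have hpsd := hP.posSemidef hmin
  have hnn := (posSemidef_iff_quadForm hP.1).1 hpsd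
  have hlmi := hP.solvesLMI hQ hR
  have hKnn := (posSemidef_iff_quadForm hlmi.2.1).1 hlmi.2
  refine (posDef_iff_quadForm hP.1).2 fun x₀ hx₀ => (hnn x₀).lt_of_ne' fun hzero => ?_
  obtain ⟨x, u, h, rfl, hE, hlim⟩ := hmin x₀
  -- Nonpositive energy equals final storage plus dissipation, both nonnegative, as the initial
  -- storage is $0$; hence the dissipation vanishes.
  have hae : ∀ T : ℝ, 0 ≤ T → ∀ᵐ t : ℝ, t ∈ Set.Ioc 0 T →
      quadForm (-lmi A B Q S R P) (Sum.elim (x t) (u t)) = 0 := fun T hT => by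
    have h1 := h.energy_eq_add_integral (Q := Q) (S := S) (R := R) hP.1 hT
    have h2 := hE T hT
    have h3 := hnn (x T)
    have h4 := intervalIntegral.integral_nonneg (μ := volume) hT fun s _ =>
      hKnn (Sum.elim (x s) (u s))
    have h5 : ∫ s in (0 : ℝ)..T, quadForm (-lmi A B Q S R P) (Sum.elim (x s) (u s)) = 0 := by
      linarith
    rw [intervalIntegral.integral_of_le hT] at h5
    have h6 := (integral_eq_zero_iff_of_nonneg (fun s => hKnn (Sum.elim (x s) (u s)))
      (h.intervalIntegrable_quadForm (-lmi A B Q S R P) hT).1).1 h5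
    exact (ae_restrict_iff' measurableSet_Ioc).1 h6
  have hK : ∀ᵐ t : ℝ, 0 < t → toComplex (-lmi A B Q S R P) *ᵥ
      Sum.elim (complexify 𝕜 ∘ x t) (complexify 𝕜 ∘ u t) = 0 := by
    filter_upwards [ae_all_iff.2 fun N : ℕ => hae N N.cast_nonneg] with t ht h0
    obtain ⟨N, hN⟩ := exists_nat_ge t
    have h1 := mulVec_eq_zero_of_quadForm_eq_zero hlmi.2 (ht N ⟨h0, hN⟩)
    rw [← Sum.comp_elim, toComplex_mulVec, h1]
    ext i
    simp
  have hlim' : Tendsto (fun t => complexify 𝕜 ∘ x t) atTop (𝓝 0) := by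
    refine tendsto_pi_nhds.2 fun i => ?_
    have h1 := (continuous_complexify.tendsto (0 : 𝕜)).comp ((tendsto_pi_nhds.1 hlim) i)
    rwa [map_zero] at h1
  have hx₀' : (fun t => complexify 𝕜 ∘ x t) 0 ≠ 0 := fun h0 => hx₀ (by
    ext i
    exact (map_eq_zero (complexify 𝕜)).1 (congrFun h0 i))
  obtain ⟨s, hs, hs', hd⟩ := hdet
  have hinj := fun v w => eq_zero_of_popov_det_ne_zero (v := v) (w := w) hs hs' hd hP.1
  obtain ⟨l, v, w, hl, hv, hlv, hKv⟩ := exists_stable_zero h.complexify hx₀' hlim' hK hinj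
  obtain ⟨p, q, hp, hpq⟩ := exists_left_null hinj hv hlv hKv
  obtain ⟨ε, hε, hbound⟩ := exists_improved_bound hlmi hl hpq
  refine hp (funext fun i => ?_)
  -- Unit vectors are states over $\mathbb K$ even if `p` is complex, and they detect every entry of
  -- `p`.
  have h1 := (hP.2 (Pi.single i 1)).2 fun e he => hbound _ e he
  have h2 : complexify 𝕜 ∘ (Pi.single i 1 : Fin m → 𝕜) = Pi.single i 1 := by
    ext j
    by_cases hj : j = i
    · subst hj
      simp
    · simp [hj]
  rw [h2, dotProduct_single_one] at h1
  have h3 : ε * ‖p i‖ ^ 2 ≤ 0 := by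
    have h4 : quadForm P (Pi.single i 1) + ε * ‖p i‖ ^ 2 ≤ quadForm P (Pi.single i 1) := h1
    linarith
  by_contra hne
  have h5 : 0 < ‖p i‖ := norm_pos_iff.2 hne
  exact absurd h3 (not_le.2 (by positivity))

end LTI

/-- If `(A, B)` is controllable, `(A, B, M)` is minimally stable, `det Π(-s, s)` is not identically
zero and the frequency inequality holds, then the matrix `P₊` of the required supply exists, is
positive definite, solves `Λ(P) ≤ 0`, and is the largest Hermitian solution. -/
theorem proposition2p11 {𝕜 : Type*} [RCLike 𝕜] {m n : ℕ}
    (A : Matrix (Fin m) (Fin m) 𝕜) (B : Matrix (Fin m) (Fin n) 𝕜)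
    (Q : Matrix (Fin m) (Fin m) 𝕜) (S : Matrix (Fin n) (Fin m) 𝕜) (R : Matrix (Fin n) (Fin n) 𝕜)
    (hQ : Q.IsHermitian) (hR : R.IsHermitian)
    (hcontr : LTI.Controllable A B)
    (hmin : LTI.MinimallyStable A B Q S R)
    (hdet : LTI.PopovDetNotIdenticallyZero A B Q S R)
    (hfdi : LTI.FrequencyInequality A B Q S R) :
    ∃ P : Matrix (Fin m) (Fin m) 𝕜,
      LTI.IsRequiredSupplyMatrix A B Q S R P ∧
      LTI.SolvesLMI A B Q S R P ∧
      P.PosDef ∧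
      ∀ P' : Matrix (Fin m) (Fin m) 𝕜, LTI.SolvesLMI A B Q S R P' → (P - P').PosSemidef := by
  obtain ⟨P, hP⟩ := LTI.exists_isRequiredSupplyMatrix (Q := Q) (S := S) (R := R) hcontr hfdi
  exact ⟨P, hP, hP.solvesLMI hQ hR, hP.posDef hQ hR hmin hdet, fun P' hP' => hP.posSemidef_sub hP'⟩
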